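/- **Terms.** Let $\Gamma=(p_1,\dots,p_\ell)$ be a list of parameters and $\Delta=(x_1{:}m_1,\dots,x_k{:}m_k)$ a list of variables with arities $m_i\in\mathbb N$ ($\ell,k\ge 0$). The terms $\Gamma\mid\Delta\vdash t$ of the Beta-Bernoulli theory, taken up to renaming of bound parameters, are generated by: $x(q_1,\dots,q_m)$ for $x{:}m$ in $\Delta$ and $q_1,\dots,q_m\in\Gamma$; $\nu_{i,j}p.\,t$ for integers $i,j>0$ and a term $\Gamma,p\mid\Delta\vdash t$ ($p$ is bound); $t\,?_p\,u$ for $p\in\Gamma$; and $t\;{}_i?_j\;u$ for $i,j\in\mathbb N$ with $i+j>0$, where $\Gamma\mid\Delta\vdash t,u$. **Derivable equality.** $\Gamma\mid\Delta\vdash t=u$ is the closure of the following equations under (capture-avoiding) substitution of parameters for parameters and of terms for variables, congruence, reflexivity, symmetry and transitivity. The indices range over all natural numbers for which the terms are well formed; $w,x,y,z$ have the arities shown. - Rational convexity: $(w\,{}_i?_j\,x)\,{}_{i+j}?_{k+l}\,(y\,{}_k?_l\,z)=(w\,{}_i?_k\,y)\,{}_{i+k}?_{j+l}\,(x\,{}_j?_l\,z)$,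 $\;x\,{}_i?_j\,y=y\,{}_j?_i\,x$, $\;x\,{}_i?_0\,y=x$, $\;x\,{}_i?_j\,x=x$. - (C1) $(w\,?_q\,x)\,?_p\,(y\,?_q\,z)=(w\,?_p\,y)\,?_q\,(x\,?_p\,z)$. - (C2) $\nu_{i,j}p.\nu_{k,l}q.\,x(p,q)=\nu_{k,l}q.\nu_{i,j}p.\,x(p,q)$. - (C3) $\nu_{i,j}p.(x(p)\,?_q\,y(p))=(\nu_{i,j}p.x(p))\,?_q\,(\nu_{i,j}p.y(p))$. - (C4) $\nu_{i,j}p.(x(p)\,{}_k?_l\,y(p))=(\nu_{i,j}p.x(p))\,{}_k?_l\,(\nu_{i,j}p.y(p))$. - (C5) $(w\,{}_i?_j\,x)\,?_p\,(y\,{}_i?_j\,z)=(w\,?_p\,y)\,{}_i?_j\,(x\,?_p\,z)$. - (D1) $\nu_{i,j}p.\,x=x$; (D2) $x\,?_p\,x=x$. - (Conj) $\nu_{i,j}p.(x(p)\,?_p\,y(p))=(\nu_{i+1,j}p.x(p))\,{}_i?_j\,(\nu_{i,j+1}p.y(p))$. **Interpretation.** Let $I=[0,1]$ and let $\beta_{i,j}$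 be the $\mathrm{Beta}(i,j)$ distribution on $I$, with density $q\mapsto q^{i-1}(1-q)^{j-1}/B(i,j)$. Put $[\![\Delta]\!]=\coprod_{i=1}^k I^{m_i}$ with its Borel $\sigma$-algebra. A term $\Gamma\mid\Delta\vdash t$ is interpreted as the probability kernel $[\![t]\!]$ from $I^\ell$ to $[\![\Delta]\!]$ given, for $\vec p\in I^\ell$ and measurable $U\subseteq[\![\Delta]\!]$, by - $[\![x_i(p_{j_1},\dots,p_{j_m})]\!](\vec p,U)=1$ if $(i,p_{j_1},\dots,p_{j_m})\in U$, and $0$ otherwise; - $[\![u\,{}_i?_j\,v]\!](\vec p,U)=\frac1{i+j}\big(i\,[\![u]\!](\vec p,U)+j\,[\![v]\!](\vec p,U)\big)$; - $[\![u\,?_{p_j}\,v]\!](\vec p,U)=p_j\,[\![u]\!](\vec p,U)+(1-p_j)\,[\![v]\!](\vec p,U)$; - $[\![\nu_{i,j}q.\,t]\!](\vec p,U)=\int_0^1[\![t]\!]((\vec p,q),U)\,\beta_{i,j}(\mathrm dq)$. **Theorem (Completeness).** If $\Gamma\mid\Delta\vdash t$ and $\Gamma\mid\Delta\vdash t'$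 are terms in the same context and $[\![t]\!]=[\![t']\!]$ as probability kernels, then $\Gamma\mid\Delta\vdash t=t'$ is derivable. -/

import Mathlib

namespace BetaBernoulli

open MeasureTheory ProbabilityTheory
open scoped ENNReal unitInterval

/-! ### Terms

A parameter context `Γ = (p₁, …, p_ℓ)` is represented by its length `ℓ`; parameters are the elements
of `Fin ℓ`. A variable context `Δ = (x₁ : m₁, …, x_k : m_k)` is the function `Δ : Fin k → ℕ` of
arities. Binding is nameless, so that terms are taken up to renaming of bound parameters: the
parameter bound by `ν` over `Γ` is the last entry `Fin.last ℓ` of the extended context `Γ, p`, and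
the parameters of `Γ` are embedded into `Γ, p` by `Fin.castSucc`. -/

/-- `Term Δ ℓ` is the type of terms `Γ | Δ ⊢ t` of the Beta-Bernoulli theory,
where `Γ` consists of `ℓ` parameters. -/
inductive Term {k : ℕ} (Δ : Fin k → ℕ) : ℕ → Type
  /-- `x(p₁, …, p_m)` for a variable `x : m` of `Δ` -/
  | var {ℓ : ℕ} (x : Fin k) (p : Fin (Δ x) → Fin ℓ) : Term Δ ℓ
  /-- `ν_{i,j} p. t` for `i, j > 0` -/
  | nu {ℓ : ℕ} (i j : ℕ) (hi : 0 < i) (hj : 0 < j) (t : Term Δ (ℓ + 1)) : Term Δ ℓ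
  /-- the parameter choice `t ?_p u` -/
  | pch {ℓ : ℕ} (p : Fin ℓ) (t u : Term Δ ℓ) : Term Δ ℓ
  /-- the rational choice `t _i?_j u` for `i + j > 0` -/
  | rch {ℓ : ℕ} (i j : ℕ) (h : 0 < i + j) (t u : Term Δ ℓ) : Term Δ ℓ

namespace Term

variable {k : ℕ} {Δ : Fin k → ℕ}

/-- The extension of a map of parameters under a binder; it fixes the bound parameter. -/
def lift {ℓ ℓ' : ℕ} (ρ : Fin ℓ → Fin ℓ') : Fin (ℓ + 1) → Fin (ℓ' + 1) :=
  Fin.snoc (α := fun _ => Fin (ℓ' + 1)) (fun q => (ρ q).castSucc) (Fin.last ℓ')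

/-- Substitution of parameters for parameters. -/
def rename {ℓ ℓ' : ℕ} (ρ : Fin ℓ → Fin ℓ') : Term Δ ℓ → Term Δ ℓ'
  | var x p => var x (fun a => ρ (p a))
  | nu i j hi hj t => nu i j hi hj (t.rename (lift ρ))
  | pch p t u => pch (ρ p) (t.rename ρ) (u.rename ρ)
  | rch i j h t u => rch i j h (t.rename ρ) (u.rename ρ)

/-- Weakening of `Γ, q₁, …, q_m | Δ ⊢ v` to `Γ, p, q₁, …, q_m | Δ ⊢ v`. -/
def weaken {ℓ m : ℕ} (v : Term Δ (ℓ + m)) : Term Δ (ℓ + 1 + m) :=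
  v.rename (Fin.append (fun a : Fin ℓ => Fin.castAdd m a.castSucc)
    (fun b : Fin m => Fin.natAdd (ℓ + 1) b))

/-- Simultaneous capture-avoiding substitution: parameters `p ∈ Γ` are replaced by parameters
`ρ p ∈ Γ'`, and every variable `x : m` of `Δ` is replaced by a term `θ x` over
`Γ', q₁, …, q_m | Δ'`, that is, `x(p₁, …, p_m)` becomes `θ x` with `ρ p₁, …, ρ p_m` for
`q₁, …, q_m`. -/
def subst {k' : ℕ} {Δ' : Fin k' → ℕ} {ℓ ℓ' : ℕ} (ρ : Fin ℓ → Fin ℓ')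
    (θ : (x : Fin k) → Term Δ' (ℓ' + Δ x)) : Term Δ ℓ → Term Δ' ℓ'
  | var x p => (θ x).rename (Fin.append id (fun a => ρ (p a)))
  | nu i j hi hj t => nu i j hi hj (t.subst (lift ρ) (fun x => (θ x).weaken))
  | pch p t u => pch (ρ p) (t.subst ρ θ) (u.subst ρ θ)
  | rch i j h t u => rch i j h (t.subst ρ θ) (u.subst ρ θ)

end Term

/-! ### The equational theory -/

/-- A variable context consisting of `k` variables of arity `m` each. -/
abbrev ctx (k m : ℕ) : Fin k → ℕ := fun _ => m

/-- The variable `x : 0` as a term `x()`. -/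
abbrev var₀ {k ℓ : ℕ} (x : Fin k) : Term (ctx k 0) ℓ := .var x ![]

/-- The term `x(p)` for a variable `x : 1`. -/
abbrev var₁ {k ℓ : ℕ} (x : Fin k) (p : Fin ℓ) : Term (ctx k 1) ℓ := .var x ![p]

/-- The term `x(p, q)` for a variable `x : 2`. -/
abbrev var₂ {k ℓ : ℕ} (x : Fin k) (p q : Fin ℓ) : Term (ctx k 2) ℓ := .var x ![p, q]

open Term in
/-- The equations of the Beta-Bernoulli theory, each in its own context. Variables called
`w, x, y, z` on paper are numbered from `0` in the order in which the context lists them. -/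
inductive Ax : {k : ℕ} → {Δ : Fin k → ℕ} → {ℓ : ℕ} → Term Δ ℓ → Term Δ ℓ → Prop
  /-- `(w _i?_j x) _{i+j}?_{k+l} (y _k?_l z) = (w _i?_k y) _{i+k}?_{j+l} (x _j?_l z)` -/
  | exchange (i j k l : ℕ) (hij : 0 < i + j) (hkl : 0 < k + l) (hik : 0 < i + k) (hjl : 0 < j + l)
      (h : 0 < (i + j) + (k + l)) (h' : 0 < (i + k) + (j + l)) :
      Ax (Δ := ctx 4 0) (ℓ := 0)
        (rch (i + j) (k + l) h (rch i j hij (var₀ 0) (var₀ 1)) (rch k l hkl (var₀ 2) (var₀ 3)))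
        (rch (i + k) (j + l) h' (rch i k hik (var₀ 0) (var₀ 2)) (rch j l hjl (var₀ 1) (var₀ 3)))
  /-- `x _i?_j y = y _j?_i x` -/
  | swap (i j : ℕ) (h : 0 < i + j) (h' : 0 < j + i) :
      Ax (Δ := ctx 2 0) (ℓ := 0) (rch i j h (var₀ 0) (var₀ 1)) (rch j i h' (var₀ 1) (var₀ 0))
  /-- `x _i?_0 y = x` -/
  | unit (i : ℕ) (h : 0 < i + 0) :
      Ax (Δ := ctx 2 0) (ℓ := 0) (rch i 0 h (var₀ 0) (var₀ 1)) (var₀ 0)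
  /-- `x _i?_j x = x` -/
  | idem (i j : ℕ) (h : 0 < i + j) :
      Ax (Δ := ctx 1 0) (ℓ := 0) (rch i j h (var₀ 0) (var₀ 0)) (var₀ 0)
  /-- `(w ?_q x) ?_p (y ?_q z) = (w ?_p y) ?_q (x ?_p z)` over `Γ = (p, q)` -/
  | C1 :
      Ax (Δ := ctx 4 0) (ℓ := 2)
        (pch 0 (pch 1 (var₀ 0) (var₀ 1)) (pch 1 (var₀ 2) (var₀ 3)))
        (pch 1 (pch 0 (var₀ 0) (var₀ 2)) (pch 0 (var₀ 1) (var₀ 3)))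
  /-- `ν_{i,j}p. ν_{k,l}q. x(p,q) = ν_{k,l}q. ν_{i,j}p. x(p,q)` -/
  | C2 (i j k l : ℕ) (hi : 0 < i) (hj : 0 < j) (hk : 0 < k) (hl : 0 < l) :
      Ax (Δ := ctx 1 2) (ℓ := 0)
        (nu i j hi hj (nu k l hk hl (var₂ 0 0 1)))
        (nu k l hk hl (nu i j hi hj (var₂ 0 1 0)))
  /-- `ν_{i,j}p. (x(p) ?_q y(p)) = (ν_{i,j}p. x(p)) ?_q (ν_{i,j}p. y(p))` over `Γ = (q)` -/
  | C3 (i j : ℕ) (hi : 0 < i) (hj : 0 < j) :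
      Ax (Δ := ctx 2 1) (ℓ := 1)
        (nu i j hi hj (pch 0 (var₁ 0 1) (var₁ 1 1)))
        (pch 0 (nu i j hi hj (var₁ 0 1)) (nu i j hi hj (var₁ 1 1)))
  /-- `ν_{i,j}p. (x(p) _k?_l y(p)) = (ν_{i,j}p. x(p)) _k?_l (ν_{i,j}p. y(p))` -/
  | C4 (i j k l : ℕ) (hi : 0 < i) (hj : 0 < j) (hkl : 0 < k + l) :
      Ax (Δ := ctx 2 1) (ℓ := 0)
        (nu i j hi hj (rch k l hkl (var₁ 0 0) (var₁ 1 0)))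
        (rch k l hkl (nu i j hi hj (var₁ 0 0)) (nu i j hi hj (var₁ 1 0)))
  /-- `(w _i?_j x) ?_p (y _i?_j z) = (w ?_p y) _i?_j (x ?_p z)` over `Γ = (p)` -/
  | C5 (i j : ℕ) (h : 0 < i + j) :
      Ax (Δ := ctx 4 0) (ℓ := 1)
        (pch 0 (rch i j h (var₀ 0) (var₀ 1)) (rch i j h (var₀ 2) (var₀ 3)))
        (rch i j h (pch 0 (var₀ 0) (var₀ 2)) (pch 0 (var₀ 1) (var₀ 3)))
  /-- `ν_{i,j}p. x = x` -/
  | D1 (i j : ℕ) (hi : 0 < i) (hj : 0 < j) :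
      Ax (Δ := ctx 1 0) (ℓ := 0) (nu i j hi hj (var₀ 0)) (var₀ 0)
  /-- `x ?_p x = x` over `Γ = (p)` -/
  | D2 :
      Ax (Δ := ctx 1 0) (ℓ := 1) (pch 0 (var₀ 0) (var₀ 0)) (var₀ 0)
  /-- `ν_{i,j}p. (x(p) ?_p y(p)) = (ν_{i+1,j}p. x(p)) _i?_j (ν_{i,j+1}p. y(p))` -/
  | conj (i j : ℕ) (hi : 0 < i) (hj : 0 < j) (hi' : 0 < i + 1) (hj' : 0 < j + 1)
      (h : 0 < i + j) :
      Ax (Δ := ctx 2 1) (ℓ := 0)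
        (nu i j hi hj (pch 0 (var₁ 0 0) (var₁ 1 0)))
        (rch i j h (nu (i + 1) j hi' hj (var₁ 0 0)) (nu i (j + 1) hi hj' (var₁ 1 0)))

/-- `Deriv t u` says that `Γ | Δ ⊢ t = u` is derivable: the closure of the equations `Ax` under
substitution, congruence, reflexivity, symmetry and transitivity. -/
inductive Deriv : {k : ℕ} → {Δ : Fin k → ℕ} → {ℓ : ℕ} → Term Δ ℓ → Term Δ ℓ → Prop
  | ax {k : ℕ} {Δ : Fin k → ℕ} {ℓ : ℕ} {t u : Term Δ ℓ} : Ax t u → Deriv t u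
  | subst {k k' : ℕ} {Δ : Fin k → ℕ} {Δ' : Fin k' → ℕ} {ℓ ℓ' : ℕ} {t u : Term Δ ℓ}
      (ρ : Fin ℓ → Fin ℓ') (θ : (x : Fin k) → Term Δ' (ℓ' + Δ x)) :
      Deriv t u → Deriv (t.subst ρ θ) (u.subst ρ θ)
  | nu {k : ℕ} {Δ : Fin k → ℕ} {ℓ : ℕ} {t u : Term Δ (ℓ + 1)}
      (i j : ℕ) (hi : 0 < i) (hj : 0 < j) :
      Deriv t u → Deriv (Term.nu i j hi hj t) (Term.nu i j hi hj u)
  | pch {k : ℕ} {Δ : Fin k → ℕ} {ℓ : ℕ} {t t' u u' : Term Δ ℓ} (p : Fin ℓ) :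
      Deriv t t' → Deriv u u' → Deriv (Term.pch p t u) (Term.pch p t' u')
  | rch {k : ℕ} {Δ : Fin k → ℕ} {ℓ : ℕ} {t t' u u' : Term Δ ℓ} (i j : ℕ) (h : 0 < i + j) :
      Deriv t t' → Deriv u u' → Deriv (Term.rch i j h t u) (Term.rch i j h t' u')
  | refl {k : ℕ} {Δ : Fin k → ℕ} {ℓ : ℕ} (t : Term Δ ℓ) : Deriv t t
  | symm {k : ℕ} {Δ : Fin k → ℕ} {ℓ : ℕ} {t u : Term Δ ℓ} : Deriv t u → Deriv u t
  | trans {k : ℕ} {Δ : Fin k → ℕ} {ℓ : ℕ} {t u v : Term Δ ℓ} :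
      Deriv t u → Deriv u v → Deriv t v

/-! ### The interpretation by probability kernels -/

/-- The beta distribution `β_{i,j}` as a measure on the unit interval. -/
noncomputable def betaI (i j : ℕ) : Measure I :=
  (betaMeasure (i : ℝ) (j : ℝ)).comap ((↑) : I → ℝ)

theorem isProbabilityMeasure_betaI {i j : ℕ} (hi : 0 < i) (hj : 0 < j) :
    IsProbabilityMeasure (betaI i j) := by
  have hp : IsProbabilityMeasure (betaMeasure (i : ℝ) (j : ℝ)) :=
    isProbabilityMeasureBeta (by exact_mod_cast hi) (by exact_mod_cast hj)
  constructor
  have hI : MeasurableSet (I : Set ℝ) := measurableSet_Icc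
  rw [betaI, (MeasurableEmbedding.subtype_coe hI).comap_apply, Set.image_univ, Subtype.range_coe,
    ← prob_compl_eq_zero_iff hI, betaMeasure, withDensity_apply _ hI.compl]
  refine setLIntegral_eq_zero hI.compl fun x hx => ?_
  by_cases h0 : x ≤ 0
  · exact betaPDF_eq_zero_of_nonpos h0
  · exact betaPDF_eq_zero_of_one_le (not_lt.1 fun h1 => hx ⟨(not_le.1 h0).le, h1.le⟩)

/-- The space `⟦Δ⟧ = ∑ₓ I^{m_x}`, with its Borel σ-algebra (that of the disjoint union). -/
abbrev Space {k : ℕ} (Δ : Fin k → ℕ) : Type := Σ x : Fin k, (Fin (Δ x) → I)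

theorem measurable_snoc (ℓ : ℕ) :
    Measurable (fun a : (Fin ℓ → I) × I =>
      (Fin.snoc (α := fun _ => I) a.1 a.2 : Fin (ℓ + 1) → I)) := by
  refine measurable_pi_lambda _ fun c => ?_
  refine Fin.lastCases ?_ (fun b => ?_) c
  · simpa using measurable_snd
  · simpa [Function.comp_def] using
      (measurable_pi_apply (X := fun _ : Fin ℓ => I) b).comp (measurable_fst (β := I))

section Kernels

variable {ℓ : ℕ} {Y : Type} [MeasurableSpace Y]

/-- `(i + j)⁻¹ (i κ + j η)` -/
noncomputable def rchKernel (i j : ℕ) (κ η : Kernel (Fin ℓ → I) Y) : Kernel (Fin ℓ → I) Y where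
  toFun p := ((i + j : ℕ) : ℝ≥0∞)⁻¹ • ((i : ℝ≥0∞) • κ p + (j : ℝ≥0∞) • η p)
  measurable' := by
    refine Measure.measurable_of_measurable_coe _ fun U hU => ?_
    simp only [Measure.smul_apply, Measure.add_apply, smul_eq_mul]
    exact ((((κ.measurable_coe hU).const_mul _).add ((η.measurable_coe hU).const_mul _)).const_mul _)

/-- `p_a κ + (1 - p_a) η` -/
noncomputable def pchKernel (a : Fin ℓ) (κ η : Kernel (Fin ℓ → I) Y) : Kernel (Fin ℓ → I) Y where
  toFun p := ENNReal.ofReal (p a) • κ p + ENNReal.ofReal (1 - p a) • η p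
  measurable' := by
    refine Measure.measurable_of_measurable_coe _ fun U hU => ?_
    simp only [Measure.smul_apply, Measure.add_apply, smul_eq_mul]
    have h : Measurable fun p : Fin ℓ → I => ((p a : I) : ℝ) :=
      measurable_subtype_coe.comp (measurable_pi_apply a)
    exact (h.ennreal_ofReal.mul (κ.measurable_coe hU)).add
      ((h.const_sub 1).ennreal_ofReal.mul (η.measurable_coe hU))

/-- `U ↦ ∫₀¹ κ((p, q), U) β_{i,j}(dq)` -/
noncomputable def nuKernel (i j : ℕ) (hi : 0 < i) (hj : 0 < j) (κ : Kernel (Fin (ℓ + 1) → I) Y) :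
    Kernel (Fin ℓ → I) Y where
  toFun p := (betaI i j).bind fun q => κ (Fin.snoc (α := fun _ => I) p q)
  measurable' := by
    have := isProbabilityMeasure_betaI hi hj
    have hm : Measurable fun a : (Fin ℓ → I) × I => κ (Fin.snoc (α := fun _ => I) a.1 a.2) :=
      κ.measurable.comp (measurable_snoc ℓ)
    refine Measure.measurable_of_measurable_coe _ fun U hU => ?_
    have h : ∀ p : Fin ℓ → I, (betaI i j).bind (fun q => κ (Fin.snoc (α := fun _ => I) p q)) U
        = ∫⁻ q, κ (Fin.snoc (α := fun _ => I) p q) U ∂(betaI i j) := fun p =>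
      Measure.bind_apply hU (hm.comp measurable_prodMk_left).aemeasurable
    simp only [h]
    exact ((Measure.measurable_coe hU).comp hm).lintegral_prod_right'

theorem nuKernel_apply (i j : ℕ) (hi : 0 < i) (hj : 0 < j) (κ : Kernel (Fin (ℓ + 1) → I) Y)
    (p : Fin ℓ → I) {U : Set Y} (hU : MeasurableSet U) :
    nuKernel i j hi hj κ p U = ∫⁻ q, κ (Fin.snoc (α := fun _ => I) p q) U ∂(betaI i j) :=
  Measure.bind_apply hU
    (κ.measurable.comp ((measurable_snoc ℓ).comp measurable_prodMk_left)).aemeasurable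

end Kernels

/-- The interpretation `⟦t⟧` of a term `Γ | Δ ⊢ t` as a kernel from `I^ℓ` to `⟦Δ⟧`. -/
noncomputable def Term.interp {k : ℕ} {Δ : Fin k → ℕ} :
    {ℓ : ℕ} → Term Δ ℓ → Kernel (Fin ℓ → I) (Space Δ)
  | _, .var x p =>
      { toFun := fun r => Measure.dirac (⟨x, fun a => r (p a)⟩ : Space Δ)
        measurable' := Measure.measurable_dirac.comp <| Measurable.comp
          (g := fun s : Fin (Δ x) → I => (⟨x, s⟩ : Space Δ))
          (fun _ hU => MeasurableSpace.measurableSet_iInf.1 hU x)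
          (measurable_pi_lambda _ fun a => measurable_pi_apply (p a)) }
  | _, .nu i j hi hj t => nuKernel i j hi hj t.interp
  | _, .pch a t u => pchKernel a t.interp u.interp
  | _, .rch i j _ t u => rchKernel i j t.interp u.interp

/-- The interpretation of a term is a probability kernel. -/
theorem Term.isMarkovKernel_interp {k : ℕ} {Δ : Fin k → ℕ} {ℓ : ℕ} (t : Term Δ ℓ) :
    IsMarkovKernel t.interp := by
  induction t with
  | var x p => exact ⟨fun r => Measure.dirac.isProbabilityMeasure⟩
  | nu i j hi hj t ih =>
    have := isProbabilityMeasure_betaI hi hj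
    refine ⟨fun p => ⟨?_⟩⟩
    rw [Term.interp, nuKernel_apply _ _ _ _ _ _ MeasurableSet.univ]
    simp
  | pch a t u iht ihu =>
    refine ⟨fun p => ⟨?_⟩⟩
    change ENNReal.ofReal (p a) * t.interp p Set.univ
      + ENNReal.ofReal (1 - p a) * u.interp p Set.univ = 1
    rw [measure_univ, measure_univ, mul_one, mul_one,
      ← ENNReal.ofReal_add (p a).2.1 (sub_nonneg.2 (p a).2.2)]
    simp
  | rch i j h t u iht ihu =>
    refine ⟨fun p => ⟨?_⟩⟩
    change ((i + j : ℕ) : ℝ≥0∞)⁻¹ * ((i : ℝ≥0∞) * t.interp p Set.univ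
      + (j : ℝ≥0∞) * u.interp p Set.univ) = 1
    rw [measure_univ, measure_univ, mul_one, mul_one, ← Nat.cast_add]
    exact ENNReal.inv_mul_cancel (by exact_mod_cast h.ne') (ENNReal.natCast_ne_top _)

end BetaBernoulli

namespace BetaBernoulli

open MeasureTheory ProbabilityTheory
open scoped ENNReal unitInterval

/-! ### Renaming of parameters, and the renamings that substitution into the axioms produces -/

namespace Term

variable {k : ℕ} {Δ : Fin k → ℕ}

/-! Every term is provably equal to a normal form whose data are determined by its kernel. The work
takes place modulo equations that are both derivable and valid for expectations of continuous
functions (`Eqv`), so that soundness is built into the quotient.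

Existence of normal forms (`exists_isNormal`). Choices on free parameters are gathered at the root
into a full tree over a list of parameters, with leaves depending only on how often each parameter
came up (C1, C5, D2; `pch_tree`). A `ν` is pushed through this tree by C3 and absorbs choices on its
own parameter by Conj. Conj with D2 splits a `ν` into two whose index sum is larger by one
(`nu_eq_mix`), so all `ν` can be given the same sum `N + 2`. By C2 and D1 each `ν` moves to the
first use of its parameter or disappears, which leaves chains. A leaf is thus a rational average of
finitely many chains. Both `N` and the list can be enlarged, so two terms can share them.

Uniqueness. At pairwise distinct parameters the expectations of chains are linearly independent
(`Chain.eq_zero_of_sum_expect_eq_zero`): an old parameter as first argument gives an atom, a fresh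
one gives a density, and the densities with fixed index sum form a Bernstein basis. A tree with real
leaves is, up to a positive factor, a polynomial in the odds of the parameters whose coefficients
are positive multiples of the leaves (`eq_zero_of_realTree_eq_zero`). Equal kernels therefore give
equal frequencies of chains at every leaf, and averages of proportional multisets coincide
(`IsAverage.eq_of_proportional`). -/

@[simp] theorem lift_castSucc {ℓ ℓ' : ℕ} (ρ : Fin ℓ → Fin ℓ') (q : Fin ℓ) :
    lift ρ q.castSucc = (ρ q).castSucc := by simp [lift]

@[simp] theorem lift_last {ℓ ℓ' : ℕ} (ρ : Fin ℓ → Fin ℓ') :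
    lift ρ (Fin.last ℓ) = Fin.last ℓ' := by simp [lift]

theorem lift_id {ℓ : ℕ} : lift (id : Fin ℓ → Fin ℓ) = id := by
  funext q
  refine Fin.lastCases ?_ (fun q => ?_) q <;> simp

theorem lift_comp {ℓ ℓ' ℓ'' : ℕ} (τ : Fin ℓ' → Fin ℓ'') (ρ : Fin ℓ → Fin ℓ') :
    lift τ ∘ lift ρ = lift (τ ∘ ρ) := by
  funext q
  refine Fin.lastCases ?_ (fun q => ?_) q <;> simp

@[simp] theorem rename_id {ℓ : ℕ} (t : Term Δ ℓ) : t.rename id = t := by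
  induction t with
  | var x p => rfl
  | nu i j hi hj t ih => simp [rename, lift_id, ih]
  | pch p t u iht ihu => simp [rename, iht, ihu]
  | rch i j h t u iht ihu => simp [rename, iht, ihu]

theorem rename_rename {ℓ ℓ' ℓ'' : ℕ} (ρ : Fin ℓ → Fin ℓ') (τ : Fin ℓ' → Fin ℓ'')
    (t : Term Δ ℓ) : (t.rename ρ).rename τ = t.rename (τ ∘ ρ) := by
  induction t generalizing ℓ' ℓ'' with
  | var x p => rfl
  | nu i j hi hj t ih => simp [rename, ih, lift_comp]
  | pch p t u iht ihu => simp [rename, iht, ihu]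
  | rch i j h t u iht ihu => simp [rename, iht, ihu]

/-- Removes the renaming left behind when a term is substituted for a variable of arity zero. -/
theorem rename_append_zero {ℓ : ℕ} (f : Fin 0 → Fin ℓ) (t : Term Δ ℓ) :
    Term.rename (ℓ := ℓ + 0) (Fin.append id f) t = t := by
  have : (Fin.append id f : Fin (ℓ + 0) → Fin ℓ) = id := by
    funext a
    exact Fin.append_left id f a
  rw [this]
  exact rename_id t

theorem weaken_zero {ℓ : ℕ} (t : Term Δ ℓ) :
    Term.weaken (m := 0) t = t.rename Fin.castSucc := by
  have : (Fin.append (fun a : Fin ℓ => Fin.castAdd 0 a.castSucc)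
    (fun b : Fin 0 => Fin.natAdd (ℓ + 1) b) : Fin (ℓ + 0) → Fin (ℓ + 1 + 0)) = Fin.castSucc := by
    funext a
    exact Fin.append_left _ _ a
  rw [weaken, this]

theorem rename_weaken_one {ℓ : ℕ} (f : Fin 1 → Fin (ℓ + 1)) (hf : f 0 = Fin.last ℓ)
    (t : Term Δ (ℓ + 1)) :
    (Term.weaken (m := 1) t).rename (Fin.append id f) = t := by
  rw [weaken, rename_rename]
  convert rename_id t using 2
  funext a
  refine Fin.addCases (fun b => ?_) (fun b => ?_) a
  · simp only [Function.comp_apply, Fin.append_left]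
    rfl
  · simp only [Function.comp_apply, Fin.append_right]
    rw [Subsingleton.elim b 0, hf]
    rfl

/-- The transposition of the last two parameters. -/
def swapLast (ℓ : ℕ) : Fin (ℓ + 2) → Fin (ℓ + 2) :=
  Equiv.swap (Fin.last ℓ).castSucc (Fin.last (ℓ + 1))

@[simp] theorem swapLast_last (ℓ : ℕ) :
    swapLast ℓ (Fin.last (ℓ + 1)) = (Fin.last ℓ).castSucc := by simp [swapLast]

@[simp] theorem swapLast_castSucc_last (ℓ : ℕ) :
    swapLast ℓ (Fin.last ℓ).castSucc = Fin.last (ℓ + 1) := by simp [swapLast]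

@[simp] theorem swapLast_castSucc_castSucc {ℓ : ℕ} (q : Fin ℓ) :
    swapLast ℓ q.castSucc.castSucc = q.castSucc.castSucc :=
  Equiv.swap_apply_of_ne_of_ne (by simp [Fin.ext_iff]; omega) (by simp [Fin.ext_iff]; omega)

/-- The two sides of C2 pass the bound parameters in opposite orders; they correspond to `τ = id`
and `τ = swapLast ℓ`. -/
theorem rename_weaken_weaken_two {ℓ : ℕ} (f : Fin 2 → Fin (ℓ + 2)) (τ : Fin (ℓ + 2) → Fin (ℓ + 2))
    (hτ : ∀ q : Fin ℓ, τ q.castSucc.castSucc = q.castSucc.castSucc)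
    (h0 : f 0 = τ (Fin.last ℓ).castSucc) (h1 : f 1 = τ (Fin.last (ℓ + 1)))
    (t : Term Δ (ℓ + 2)) :
    (Term.weaken (m := 2) (Term.weaken (m := 2) t)).rename (Fin.append id f) = t.rename τ := by
  rw [weaken, weaken, rename_rename, rename_rename]
  congr 1
  funext a
  refine Fin.addCases (fun b => ?_) (fun b => ?_) a
  · simp only [Function.comp_apply, Fin.append_left]
    exact (hτ b).symm
  · simp only [Function.comp_apply, Fin.append_right]
    fin_cases b
    · exact h0
    · exact h1

end Term

/-! ### The axioms with arbitrary terms in place of variables -/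

namespace Deriv

open Term

variable {k ℓ : ℕ} {Δ : Fin k → ℕ}

theorem rch_exchange (i j k' l : ℕ) (hij : 0 < i + j) (hkl : 0 < k' + l) (hik : 0 < i + k')
    (hjl : 0 < j + l) (h : 0 < (i + j) + (k' + l)) (h' : 0 < (i + k') + (j + l))
    (w x y z : Term Δ ℓ) :
    Deriv (Term.rch (i + j) (k' + l) h (Term.rch i j hij w x) (Term.rch k' l hkl y z))
      (Term.rch (i + k') (j + l) h' (Term.rch i k' hik w y) (Term.rch j l hjl x z)) := by
  have := Deriv.subst (Δ := ctx 4 0) (Δ' := Δ) (ℓ' := ℓ) Fin.elim0 ![w, x, y, z]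
    (Deriv.ax (Ax.exchange i j k' l hij hkl hik hjl h h'))
  simp only [Term.subst] at this
  erw [rename_append_zero, rename_append_zero, rename_append_zero, rename_append_zero] at this
  exact this

theorem rch_swap (i j : ℕ) (h : 0 < i + j) (h' : 0 < j + i) (x y : Term Δ ℓ) :
    Deriv (Term.rch i j h x y) (Term.rch j i h' y x) := by
  have := Deriv.subst (Δ := ctx 2 0) (Δ' := Δ) (ℓ' := ℓ) Fin.elim0 ![x, y] (Deriv.ax (Ax.swap i j h h'))
  simp only [Term.subst] at this
  erw [rename_append_zero, rename_append_zero] at this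
  exact this

theorem rch_unit (i : ℕ) (h : 0 < i + 0) (x y : Term Δ ℓ) :
    Deriv (Term.rch i 0 h x y) x := by
  have := Deriv.subst (Δ := ctx 2 0) (Δ' := Δ) (ℓ' := ℓ) Fin.elim0 ![x, y] (Deriv.ax (Ax.unit i h))
  simp only [Term.subst] at this
  erw [rename_append_zero, rename_append_zero] at this
  exact this

theorem rch_idem (i j : ℕ) (h : 0 < i + j) (x : Term Δ ℓ) :
    Deriv (Term.rch i j h x x) x := by
  have := Deriv.subst (Δ := ctx 1 0) (Δ' := Δ) (ℓ' := ℓ) Fin.elim0 ![x] (Deriv.ax (Ax.idem i j h))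
  simp only [Term.subst] at this
  erw [rename_append_zero] at this
  exact this

theorem pch_pch (p q : Fin ℓ) (w x y z : Term Δ ℓ) :
    Deriv (Term.pch p (Term.pch q w x) (Term.pch q y z))
      (Term.pch q (Term.pch p w y) (Term.pch p x z)) := by
  have := Deriv.subst (Δ := ctx 4 0) (Δ' := Δ) (ℓ' := ℓ) ![p, q] ![w, x, y, z] (Deriv.ax Ax.C1)
  simp only [Term.subst] at this
  erw [rename_append_zero, rename_append_zero, rename_append_zero, rename_append_zero] at this
  exact this

theorem pch_rch (p : Fin ℓ) (i j : ℕ) (h : 0 < i + j) (w x y z : Term Δ ℓ) :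
    Deriv (Term.pch p (Term.rch i j h w x) (Term.rch i j h y z))
      (Term.rch i j h (Term.pch p w y) (Term.pch p x z)) := by
  have := Deriv.subst (Δ := ctx 4 0) (Δ' := Δ) (ℓ' := ℓ) ![p] ![w, x, y, z] (Deriv.ax (Ax.C5 i j h))
  simp only [Term.subst] at this
  erw [rename_append_zero, rename_append_zero, rename_append_zero, rename_append_zero] at this
  exact this

theorem pch_idem (p : Fin ℓ) (x : Term Δ ℓ) : Deriv (Term.pch p x x) x := by
  have := Deriv.subst (Δ := ctx 1 0) (Δ' := Δ) (ℓ' := ℓ) ![p] ![x] (Deriv.ax Ax.D2)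
  simp only [Term.subst] at this
  erw [rename_append_zero] at this
  exact this

theorem nu_const (i j : ℕ) (hi : 0 < i) (hj : 0 < j) (x : Term Δ ℓ) :
    Deriv (Term.nu i j hi hj (x.rename Fin.castSucc)) x := by
  have := Deriv.subst (Δ := ctx 1 0) (Δ' := Δ) (ℓ' := ℓ) Fin.elim0 ![x] (Deriv.ax (Ax.D1 i j hi hj))
  simp only [Term.subst] at this
  erw [rename_append_zero, rename_append_zero, weaken_zero] at this
  exact this

theorem nu_rch (i j k' l : ℕ) (hi : 0 < i) (hj : 0 < j) (h : 0 < k' + l)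
    (x y : Term Δ (ℓ + 1)) :
    Deriv (Term.nu i j hi hj (Term.rch k' l h x y))
      (Term.rch k' l h (Term.nu i j hi hj x) (Term.nu i j hi hj y)) := by
  have := Deriv.subst (Δ := ctx 2 1) (Δ' := Δ) (ℓ' := ℓ) Fin.elim0 ![x, y] (Deriv.ax (Ax.C4 i j k' l hi hj h))
  simp only [Term.subst] at this
  erw [rename_weaken_one _ (by exact lift_last _), rename_weaken_one _ (by exact lift_last _)]
    at this
  exact this

theorem nu_pch_last (i j : ℕ) (hi : 0 < i) (hj : 0 < j) (hi' : 0 < i + 1) (hj' : 0 < j + 1)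
    (h : 0 < i + j) (x y : Term Δ (ℓ + 1)) :
    Deriv (Term.nu i j hi hj (Term.pch (Fin.last ℓ) x y))
      (Term.rch i j h (Term.nu (i + 1) j hi' hj x) (Term.nu i (j + 1) hi hj' y)) := by
  have := Deriv.subst (Δ := ctx 2 1) (Δ' := Δ) (ℓ' := ℓ) Fin.elim0 ![x, y]
    (Deriv.ax (Ax.conj i j hi hj hi' hj' h))
  simp only [Term.subst] at this
  erw [rename_weaken_one _ (by exact lift_last _), rename_weaken_one _ (by exact lift_last _),
    lift_last] at this
  exact this

theorem nu_pch_castSucc (i j : ℕ) (hi : 0 < i) (hj : 0 < j) (q : Fin ℓ)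
    (x y : Term Δ (ℓ + 1)) :
    Deriv (Term.nu i j hi hj (Term.pch q.castSucc x y))
      (Term.pch q (Term.nu i j hi hj x) (Term.nu i j hi hj y)) := by
  have := Deriv.subst (Δ := ctx 2 1) (Δ' := Δ) (ℓ' := ℓ) ![q] ![x, y] (Deriv.ax (Ax.C3 i j hi hj))
  simp only [Term.subst] at this
  erw [rename_weaken_one _ (by exact lift_last _), rename_weaken_one _ (by exact lift_last _),
    lift_castSucc _ (0 : Fin 1)] at this
  exact this

theorem nu_nu (i j k' l : ℕ) (hi : 0 < i) (hj : 0 < j) (hk : 0 < k') (hl : 0 < l)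
    (t : Term Δ (ℓ + 2)) :
    Deriv (Term.nu i j hi hj (Term.nu k' l hk hl t))
      (Term.nu k' l hk hl (Term.nu i j hi hj (t.rename (swapLast ℓ)))) := by
  have := Deriv.subst (Δ := ctx 1 2) (Δ' := Δ) (ℓ' := ℓ) Fin.elim0 ![t] (Deriv.ax (Ax.C2 i j k' l hi hj hk hl))
  simp only [Term.subst] at this
  have e0 : ∀ ρ : Fin 0 → Fin ℓ, lift (lift ρ) 0 = (Fin.last ℓ).castSucc := fun ρ =>
    (lift_castSucc (lift ρ) (Fin.last 0)).trans (congrArg _ (lift_last ρ))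
  have e1 : ∀ ρ : Fin 0 → Fin ℓ, lift (lift ρ) 1 = Fin.last (ℓ + 1) := fun ρ =>
    lift_last (lift ρ)
  erw [rename_weaken_weaken_two _ id (fun _ => rfl) (by exact e0 _) (by exact e1 _),
    rename_weaken_weaken_two _ (swapLast ℓ) (by simp) (by simpa using e1 _)
      (by simpa using e0 _), rename_id] at this
  exact this

end Deriv

/-! ### Integration against the beta distributions -/

instance (i j : ℕ) : IsFiniteMeasure (betaI (i + 1) (j + 1)) :=
  have := isProbabilityMeasure_betaI i.succ_pos j.succ_pos
  inferInstance

/-- Needed to conclude that a continuous function that vanishes almost everywhere vanishes. -/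
instance : (volume : Measure I).IsOpenPosMeasure where
  open_pos U hU hne := by
    obtain ⟨x, hx⟩ := hne
    obtain ⟨ε, hε, hb⟩ := Metric.isOpen_iff.1 hU x hx
    have hx0 := x.2.1
    have hx1 := x.2.2
    let a : I := ⟨max (x - ε / 2) 0, le_max_right _ _, max_le (by linarith) zero_le_one⟩
    let b : I := ⟨min (x + ε / 2) 1, le_min (by linarith) zero_le_one, min_le_right _ _⟩
    have hab : (0 : ℝ) < b - a := by
      rw [sub_pos]
      exact max_lt (lt_min (by linarith) (by linarith)) (lt_min (by linarith) (by norm_num))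
    have hsub : Set.Icc a b ⊆ U := by
      intro y hy
      refine hb ?_
      have h1 : (x : ℝ) - ε / 2 ≤ y := (le_max_left _ _).trans hy.1
      have h2 : (y : ℝ) ≤ x + ε / 2 := le_trans (show (y : ℝ) ≤ b from hy.2) (min_le_left _ _)
      rw [Metric.mem_ball, Subtype.dist_eq, Real.dist_eq, abs_lt]
      constructor <;> linarith
    refine (lt_of_lt_of_le ?_ (measure_mono hsub)).ne'
    rw [unitInterval.volume_Icc]
    exact ENNReal.ofReal_pos.2 hab

theorem integrable_of_continuous {μ : Measure I} [IsFiniteMeasure μ] {f : I → ℝ}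
    (hf : Continuous f) : Integrable f μ :=
  hf.integrable_of_hasCompactSupport (HasCompactSupport.of_compactSpace f)

/-- The unnormalized density `s ^ i (1 - s) ^ j` of `β_{i+1,j+1}`. -/
noncomputable def betaWeight (i j : ℕ) (s : I) : ℝ := (s : ℝ) ^ i * (1 - s) ^ j

theorem continuous_betaWeight (i j : ℕ) : Continuous (betaWeight i j) := by
  unfold betaWeight
  fun_prop

theorem betaI_succ_eq (i j : ℕ) :
    betaI (i + 1) (j + 1) = (volume : Measure I).withDensity
      (fun s => ENNReal.ofReal (betaWeight i j s / beta (i + 1 : ℕ) (j + 1 : ℕ))) := by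
  have hI := unitInterval.measurableEmbedding_coe
  have hpdf : betaMeasure ((i + 1 : ℕ) : ℝ) ((j + 1 : ℕ) : ℝ) =
      volume.withDensity (Set.indicator (Set.Ioo 0 1) fun x : ℝ =>
        ENNReal.ofReal (x ^ i * (1 - x) ^ j / beta (i + 1 : ℕ) (j + 1 : ℕ))) := by
    unfold betaMeasure
    congr 1
    funext x
    rw [betaPDF_eq]
    by_cases hx : 0 < x ∧ x < 1
    · rw [if_pos hx, Set.indicator_of_mem (by exact hx)]
      congr 1
      push_cast
      rw [add_sub_cancel_right, add_sub_cancel_right, Real.rpow_natCast, Real.rpow_natCast]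
      ring
    · rw [if_neg hx, Set.indicator_of_notMem (by exact hx), ENNReal.ofReal_zero]
  ext A hA
  rw [betaI, hI.comap_apply, hpdf, withDensity_apply _ (hI.measurableSet_image.2 hA),
    withDensity_apply _ hA, unitInterval.volume_def]
  have h := setLIntegral_subtype (μ := volume) (show MeasurableSet (I : Set ℝ) from measurableSet_Icc) A
    fun x : ℝ => ENNReal.ofReal (x ^ i * (1 - x) ^ j / beta (i + 1 : ℕ) (j + 1 : ℕ))
  refine Eq.trans ?_ h.symm
  refine setLIntegral_congr_fun_ae (hI.measurableSet_image.2 hA) ?_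
  -- The beta density is cut off at the endpoints, where `betaWeight` may be nonzero; these two
  -- points are null.
  have h0 : ∀ᵐ x : ℝ, x ≠ 0 := by simp [ae_iff]
  have h1 : ∀ᵐ x : ℝ, x ≠ 1 := by simp [ae_iff]
  filter_upwards [h0, h1] with x hx0 hx1 hx
  obtain ⟨y, -, rfl⟩ := hx
  exact Set.indicator_of_mem
    (show (y : ℝ) ∈ Set.Ioo 0 1 from ⟨lt_of_le_of_ne y.2.1 hx0.symm, lt_of_le_of_ne y.2.2 hx1⟩) _

theorem beta_succ_succ (i j : ℕ) :
    beta (i + 1 : ℕ) (j + 1 : ℕ) = i.factorial * j.factorial / (i + j + 1).factorial := by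
  have h : (((i + 1 : ℕ) : ℝ) + ((j + 1 : ℕ) : ℝ)) = ((i + j + 1 : ℕ) : ℝ) + 1 := by
    push_cast
    ring
  rw [beta, h, Real.Gamma_nat_eq_factorial]
  push_cast
  rw [Real.Gamma_nat_eq_factorial, Real.Gamma_nat_eq_factorial]

theorem integral_betaI (i j : ℕ) (f : I → ℝ) :
    ∫ s, f s ∂betaI (i + 1) (j + 1) =
      (∫ s, betaWeight i j s * f s) / beta (i + 1 : ℕ) (j + 1 : ℕ) := by
  have hb : 0 < beta (i + 1 : ℕ) (j + 1 : ℕ) := beta_pos (by positivity) (by positivity)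
  have hw : ∀ s, 0 ≤ betaWeight i j s := fun s =>
    mul_nonneg (pow_nonneg s.2.1 _) (pow_nonneg (sub_nonneg.2 s.2.2) _)
  rw [betaI_succ_eq, integral_withDensity_eq_integral_toReal_smul
    ((continuous_betaWeight i j).div_const _).measurable.ennreal_ofReal
    (Filter.Eventually.of_forall fun _ => ENNReal.ofReal_lt_top), ← integral_div]
  congr 1
  funext s
  rw [ENNReal.toReal_ofReal (div_nonneg (hw s) hb.le), smul_eq_mul]
  ring

/-- Soundness of Conj: the factors `s` and `1 - s` raise one exponent of the weight, and the ratios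
of the beta constants are `(i+1)/(i+j+2)` and `(j+1)/(i+j+2)`. -/
theorem integral_betaI_conj (i j : ℕ) {f g : I → ℝ} (hf : Continuous f) (hg : Continuous g) :
    ∫ s : I, ((s : ℝ) * f s + (1 - s) * g s) ∂betaI (i + 1) (j + 1) =
      (((i + 1 : ℕ) : ℝ) * ∫ s, f s ∂betaI (i + 1 + 1) (j + 1) +
        ((j + 1 : ℕ) : ℝ) * ∫ s, g s ∂betaI (i + 1) (j + 1 + 1)) /
        (((i + 1 : ℕ) : ℝ) + ((j + 1 : ℕ) : ℝ)) := by
  have e : ∀ s : I, betaWeight i j s * ((s : ℝ) * f s + (1 - s) * g s) =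
      betaWeight (i + 1) j s * f s + betaWeight i (j + 1) s * g s := fun s => by
    unfold betaWeight
    ring
  simp only [integral_betaI, e]
  rw [integral_add (f := fun s => betaWeight (i + 1) j s * f s)
    (g := fun s => betaWeight i (j + 1) s * g s)
    (integrable_of_continuous ((continuous_betaWeight _ _).mul hf))
    (integrable_of_continuous ((continuous_betaWeight _ _).mul hg))]
  simp only [beta_succ_succ]
  have e1 : i + 1 + j + 1 = i + j + 1 + 1 := by omega
  have e2 : i + (j + 1) + 1 = i + j + 1 + 1 := by omega
  rw [e1, e2, Nat.factorial_succ i, Nat.factorial_succ j, Nat.factorial_succ (i + j + 1)]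
  have h1 : (i.factorial : ℝ) ≠ 0 := by positivity
  have h2 : (j.factorial : ℝ) ≠ 0 := by positivity
  have h3 : ((i + j + 1).factorial : ℝ) ≠ 0 := by positivity
  have h4 : (i : ℝ) + 1 ≠ 0 := by positivity
  have h5 : (j : ℝ) + 1 ≠ 0 := by positivity
  have h6 : (i : ℝ) + 1 + (j + 1) ≠ 0 := by positivity
  have h7 : (i : ℝ) + j + 1 + 1 ≠ 0 := by positivity
  push_cast
  field_simp
  ring

/-! ### Expectations of continuous functions -/

section Sem

variable {k : ℕ} {Δ : Fin k → ℕ}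

/-- The expectation of `G` under the interpretation of a term, by recursion on the term. -/
noncomputable def sem (G : Space Δ → ℝ) : {ℓ : ℕ} → Term Δ ℓ → (Fin ℓ → I) → ℝ
  | _, .var x p, r => G ⟨x, fun a => r (p a)⟩
  | _, .nu i j _ _ t, r => ∫ s, sem G t (Fin.snoc (α := fun _ => I) r s) ∂betaI i j
  | _, .pch p t u, r => (r p : ℝ) * sem G t r + (1 - (r p : ℝ)) * sem G u r
  | _, .rch i j _ t u, r => ((i : ℝ) * sem G t r + (j : ℝ) * sem G u r) / ((i : ℝ) + (j : ℝ))

theorem continuous_snoc (ℓ : ℕ) :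
    Continuous (fun a : (Fin ℓ → I) × I =>
      (Fin.snoc (α := fun _ => I) a.1 a.2 : Fin (ℓ + 1) → I)) := by
  refine continuous_pi fun c => ?_
  refine Fin.lastCases ?_ (fun b => ?_) c
  · simpa using continuous_snd
  · simpa [Function.comp_def] using
      (continuous_apply (A := fun _ : Fin ℓ => I) b).comp (continuous_fst (Y := I))

variable {G : Space Δ → ℝ} (hG : ∀ x, Continuous fun v : Fin (Δ x) → I => G ⟨x, v⟩)

theorem continuous_integral_betaI {X : Type} [TopologicalSpace X] [FirstCountableTopology X]
    [LocallyCompactSpace X] (i j : ℕ) {f : X → I → ℝ} (hf : Continuous f.uncurry) :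
    Continuous fun x => ∫ s, f x s ∂betaI (i + 1) (j + 1) := by
  simpa using continuous_parametric_integral_of_continuous (μ := betaI (i + 1) (j + 1)) hf
    isCompact_univ

include hG in
theorem continuous_sem {ℓ : ℕ} (t : Term Δ ℓ) : Continuous (sem G t) := by
  induction t with
  | var x p => exact (hG x).comp (continuous_pi fun a => continuous_apply (p a))
  | nu i j hi hj t ih =>
    obtain ⟨i, rfl⟩ := Nat.exists_eq_succ_of_ne_zero hi.ne'
    obtain ⟨j, rfl⟩ := Nat.exists_eq_succ_of_ne_zero hj.ne'
    exact continuous_integral_betaI i j (ih.comp (continuous_snoc _))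
  | pch p t u iht ihu =>
    have hp : Continuous fun r : Fin _ → I => (r p : ℝ) :=
      continuous_subtype_val.comp (continuous_apply p)
    exact (hp.mul iht).add ((continuous_const.sub hp).mul ihu)
  | rch i j h t u iht ihu =>
    exact ((continuous_const.mul iht).add (continuous_const.mul ihu)).div_const _

include hG in
theorem continuous_sem_snoc {ℓ : ℕ} (t : Term Δ (ℓ + 1)) (r : Fin ℓ → I) :
    Continuous fun s : I => sem G t (Fin.snoc (α := fun _ => I) r s) :=
  (continuous_sem hG t).comp ((continuous_snoc ℓ).comp (by fun_prop : Continuous fun s => (r, s)))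

theorem snoc_comp_lift {ℓ ℓ' : ℕ} (ρ : Fin ℓ → Fin ℓ') (r : Fin ℓ' → I) (s : I) :
    (Fin.snoc (α := fun _ => I) r s : Fin (ℓ' + 1) → I) ∘ Term.lift ρ =
      Fin.snoc (α := fun _ => I) (r ∘ ρ) s := by
  funext q
  refine Fin.lastCases ?_ (fun q => ?_) q <;> simp

theorem sem_rename {ℓ ℓ' : ℕ} (ρ : Fin ℓ → Fin ℓ') (t : Term Δ ℓ) (r : Fin ℓ' → I) :
    sem G (t.rename ρ) r = sem G t (r ∘ ρ) := by
  induction t generalizing ℓ' with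
  | var x p => rfl
  | nu i j hi hj t ih => simp only [Term.rename, sem, ih, snoc_comp_lift]
  | pch p t u iht ihu => simp only [Term.rename, sem, iht, ihu, Function.comp_apply]
  | rch i j h t u iht ihu => simp only [Term.rename, sem, iht, ihu]

include hG in
theorem measurable_of_continuous_components : Measurable G := by
  intro U hU
  rw [MeasurableSpace.measurableSet_iInf]
  exact fun x => (hG x).measurable hU

include hG in
theorem exists_bound_of_continuous_components : ∃ C, ∀ y, ‖G y‖ ≤ C := by
  have h : ∀ x, ∃ C, ∀ v, ‖G ⟨x, v⟩‖ ≤ C := fun x => by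
    obtain ⟨C, hC⟩ := isCompact_univ.exists_bound_of_continuousOn (hG x).continuousOn
    exact ⟨C, fun v => hC v trivial⟩
  choose C hC using h
  refine ⟨∑ x, |C x|, fun y => (hC y.1 y.2).trans ((le_abs_self _).trans ?_)⟩
  exact Finset.single_le_sum (f := fun x => |C x|) (fun x _ => abs_nonneg _) (Finset.mem_univ y.1)

include hG in
theorem integrable_of_continuous_components {μ : Measure (Space Δ)} [IsFiniteMeasure μ] :
    Integrable G μ := by
  obtain ⟨C, hC⟩ := exists_bound_of_continuous_components hG
  exact Integrable.of_bound (measurable_of_continuous_components hG).aestronglyMeasurable C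
    (Filter.Eventually.of_forall hC)

include hG in
-- The only bridge from kernels to `sem`; equality of kernels is used through expectations alone.
theorem integral_interp {ℓ : ℕ} (t : Term Δ ℓ) (r : Fin ℓ → I) :
    ∫ y, G y ∂t.interp r = sem G t r := by
  induction t with
  | var x p =>
    exact integral_dirac' _ _ (measurable_of_continuous_components hG).stronglyMeasurable
  | nu i j hi hj t ih =>
    have := isProbabilityMeasure_betaI hi hj
    have := t.isMarkovKernel_interp
    let η : Kernel I (Space Δ) := t.interp.comap (fun s => Fin.snoc (α := fun _ => I) r s)
      ((measurable_snoc _).comp measurable_prodMk_left)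
    have e : (Term.nu i j hi hj t).interp r = (η ∘ₖ Kernel.const Unit (betaI i j)) () := by
      rw [Kernel.comp_apply]
      rfl
    rw [e, Kernel.integral_comp (integrable_of_continuous_components hG)]
    simp only [Kernel.const_apply, sem, ← ih]
    rfl
  | pch p t u iht ihu =>
    have := t.isMarkovKernel_interp
    have := u.isMarkovKernel_interp
    change ∫ y, G y ∂(ENNReal.ofReal (r p) • t.interp r + ENNReal.ofReal (1 - r p) • u.interp r) = _
    rw [integral_add_measure
      ((integrable_of_continuous_components hG).smul_measure ENNReal.ofReal_ne_top)
      ((integrable_of_continuous_components hG).smul_measure ENNReal.ofReal_ne_top),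
      integral_smul_measure, integral_smul_measure, iht, ihu, ENNReal.toReal_ofReal (r p).2.1,
      ENNReal.toReal_ofReal (sub_nonneg.2 (r p).2.2)]
    rfl
  | rch i j h t u iht ihu =>
    have := t.isMarkovKernel_interp
    have := u.isMarkovKernel_interp
    change ∫ y, G y ∂(((i + j : ℕ) : ℝ≥0∞)⁻¹ •
      ((i : ℝ≥0∞) • t.interp r + (j : ℝ≥0∞) • u.interp r)) = _
    rw [integral_smul_measure, integral_add_measure
      ((integrable_of_continuous_components hG).smul_measure (ENNReal.natCast_ne_top _))
      ((integrable_of_continuous_components hG).smul_measure (ENNReal.natCast_ne_top _)),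
      integral_smul_measure, integral_smul_measure, iht, ihu, ENNReal.toReal_inv,
      ENNReal.toReal_natCast, ENNReal.toReal_natCast, ENNReal.toReal_natCast, sem, Nat.cast_add,
      div_eq_inv_mul]
    rfl

end Sem

/-! ### Rational convexity -/

/-- Sets with rational convex combinations `mix i j x y`, read as `(i x + j y) / (i + j)`. -/
class RationalConvex (X : Type*) where
  /-- the combination `(i x + j y) / (i + j)` -/
  mix : ℕ → ℕ → X → X → X
  mix_mix {i j k l : ℕ} (hij : 0 < i + j) (hkl : 0 < k + l) (hik : 0 < i + k) (hjl : 0 < j + l)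
    (w x y z : X) : mix (i + j) (k + l) (mix i j w x) (mix k l y z) =
      mix (i + k) (j + l) (mix i k w y) (mix j l x z)
  mix_comm {i j : ℕ} (h : 0 < i + j) (x y : X) : mix i j x y = mix j i y x
  mix_zero_right {i : ℕ} (h : 0 < i) (x y : X) : mix i 0 x y = x
  mix_self {i j : ℕ} (h : 0 < i + j) (x : X) : mix i j x x = x

/-- Points of a convex set with a positive integral weight. -/
structure Weighted (X : Type*) where
  /-- the weight -/
  weight : ℕ
  /-- the weight is positive -/
  weight_pos : 0 < weight
  /-- the point -/
  point : X

section Cone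

variable {X Y : Type*} [RationalConvex X] [RationalConvex Y]

@[ext] theorem Weighted.ext {X : Type*} {a b : Weighted X} (hw : a.weight = b.weight)
    (hp : a.point = b.point) : a = b := by
  cases a
  cases b
  simp_all

instance : AddCommSemigroup (Weighted X) where
  add a b := ⟨a.weight + b.weight, Nat.add_pos_left a.weight_pos _,
    RationalConvex.mix a.weight b.weight a.point b.point⟩
  add_assoc a b c := by
    have ha := a.weight_pos
    have hb := b.weight_pos
    have hc := c.weight_pos
    refine Weighted.ext (Nat.add_assoc _ _ _) ?_
    -- Associativity is the exchange law with `k = 0`: one inner combination then collapses by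
    -- idempotence, another by the unit law.
    have h := RationalConvex.mix_mix (i := a.weight) (j := b.weight) (k := 0) (l := c.weight)
      (by omega) (by omega) (by omega) (by omega) a.point b.point c.point c.point
    rw [RationalConvex.mix_self (by omega), RationalConvex.mix_zero_right ha, Nat.zero_add] at h
    exact h
  add_comm a b := Weighted.ext (Nat.add_comm _ _)
    (RationalConvex.mix_comm (Nat.add_pos_left a.weight_pos _) _ _)

theorem Weighted.add_def (a b : Weighted X) : a + b = ⟨a.weight + b.weight,
    Nat.add_pos_left a.weight_pos _, RationalConvex.mix a.weight b.weight a.point b.point⟩ := rfl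

/-- The cone over a convex set, a commutative monoid. -/
abbrev Cone (X : Type*) : Type _ := WithZero (Weighted X)

/-- The embedding of a convex set into its cone, at height one. -/
def toCone {X : Type*} (x : X) : Cone X := ((⟨1, one_pos, x⟩ : Weighted X) : WithZero (Weighted X))

theorem nsmul_toCone {n : ℕ} (hn : 0 < n) (x : X) :
    n • toCone x = ((⟨n, hn, x⟩ : Weighted X) : WithZero (Weighted X)) := by
  induction n with
  | zero => omega
  | succ n ih =>
    rcases Nat.eq_zero_or_pos n with rfl | hn'
    · simp [toCone]
    · rw [succ_nsmul, ih hn', toCone, ← WithZero.coe_add, Weighted.add_def]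
      simp only [RationalConvex.mix_self (Nat.add_pos_left hn' _)]

/-- The cone need not be cancellative. Multiples can still be compared, since by idempotence the
`n`-fold multiple keeps the point and only changes the weight. -/
theorem nsmul_toCone_injective {n : ℕ} (hn : 0 < n) {x y : X} (h : n • toCone x = n • toCone y) :
    x = y := by
  rw [nsmul_toCone hn, nsmul_toCone hn, WithZero.coe_inj] at h
  exact congrArg Weighted.point h

theorem toCone_mix {i j : ℕ} (h : 0 < i + j) (x y : X) :
    (i + j) • toCone (RationalConvex.mix i j x y) = i • toCone x + j • toCone y := by
  rcases Nat.eq_zero_or_pos i with rfl | hi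
  · rw [RationalConvex.mix_comm h, RationalConvex.mix_zero_right (by omega)]
    simp
  rcases Nat.eq_zero_or_pos j with rfl | hj
  · rw [RationalConvex.mix_zero_right hi]
    simp
  rw [nsmul_toCone h, nsmul_toCone hi, nsmul_toCone hj, ← WithZero.coe_add, Weighted.add_def]

/-- `y` is the average of the nonempty multiset `S`. -/
def IsAverage (S : Multiset X) (y : X) : Prop :=
  S ≠ 0 ∧ S.card • toCone y = (S.map toCone).sum

theorem IsAverage.singleton (x : X) : IsAverage {x} x := by
  simp [IsAverage]

theorem IsAverage.card_pos {S : Multiset X} {y : X} (h : IsAverage S y) : 0 < S.card :=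
  Multiset.card_pos.2 h.1

/-- The multiplicities `i |T|` and `j |S|` bring the two averages to a common denominator. -/
theorem IsAverage.mix {S T : Multiset X} {x y : X} (hx : IsAverage S x) (hy : IsAverage T y)
    {i j : ℕ} (h : 0 < i + j) :
    IsAverage ((i * T.card) • S + (j * S.card) • T) (RationalConvex.mix i j x y) := by
  have hc : ((i * T.card) • S + (j * S.card) • T).card = S.card * T.card * (i + j) := by
    simp
    ring
  refine ⟨fun h0 => ?_, ?_⟩
  · rw [h0, Multiset.card_zero] at hc
    exact absurd hc.symm (Nat.mul_pos (Nat.mul_pos hx.card_pos hy.card_pos) h).ne'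
  · rw [hc, mul_nsmul', toCone_mix h]
    simp only [Multiset.map_add, Multiset.map_nsmul, Multiset.sum_add, Multiset.sum_nsmul]
    rw [← hx.2, ← hy.2]
    simp only [nsmul_add, ← mul_nsmul']
    congr 2 <;> ring

theorem IsAverage.unique {S : Multiset X} {x y : X} (hx : IsAverage S x) (hy : IsAverage S y) :
    x = y :=
  nsmul_toCone_injective hx.card_pos (hx.2.trans hy.2.symm)

theorem IsAverage.eq_of_proportional {S T : Multiset X} {x y : X} (hx : IsAverage S x)
    (hy : IsAverage T y) (h : T.card • S = S.card • T) : x = y := by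
  refine nsmul_toCone_injective (Nat.mul_pos hx.card_pos hy.card_pos) ?_
  rw [mul_comm, mul_nsmul', hx.2, mul_comm, mul_nsmul', hy.2, ← Multiset.sum_nsmul,
    ← Multiset.sum_nsmul, ← Multiset.map_nsmul, ← Multiset.map_nsmul, h]

/-- An average is built by adjoining points one at a time with weights `1 : |S|`, and `f` preserves
each stage. Uniqueness of averages then gives the statement for any given average. -/
theorem exists_isAverage_map {f : X → Y}
    (hf : ∀ i j x y, 0 < i + j → f (RationalConvex.mix i j x y) =
      RationalConvex.mix i j (f x) (f y)) (S : Multiset X) (hS : S ≠ 0) :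
    ∃ y, IsAverage S y ∧ IsAverage (S.map f) (f y) := by
  induction S using Multiset.induction_on with
  | empty => exact absurd rfl hS
  | cons x S ih =>
    by_cases h0 : S = 0
    · subst h0
      exact ⟨x, IsAverage.singleton x, by simpa using IsAverage.singleton (f x)⟩
    · obtain ⟨y, hy, hy'⟩ := ih h0
      have hc : 0 < 1 + S.card := by omega
      refine ⟨RationalConvex.mix 1 S.card x y, ⟨Multiset.cons_ne_zero, ?_⟩,
        ⟨by simp, ?_⟩⟩
      · rw [Multiset.card_cons, add_comm, toCone_mix hc, hy.2]
        simp
      · rw [Multiset.card_map, Multiset.card_cons, add_comm, hf _ _ _ _ hc, toCone_mix hc,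
          ← S.card_map f, hy'.2]
        simp

theorem IsAverage.map {S : Multiset X} {x : X} (hx : IsAverage S x) {f : X → Y}
    (hf : ∀ i j x y, 0 < i + j → f (RationalConvex.mix i j x y) =
      RationalConvex.mix i j (f x) (f y)) : IsAverage (S.map f) (f x) := by
  obtain ⟨y, hy, hy'⟩ := exists_isAverage_map hf S hx.1
  rwa [hx.unique hy]

end Cone

/-! ### Terms up to derivable equality -/

section Classes

variable {k : ℕ} {Δ : Fin k → ℕ} {ℓ : ℕ}

/-- Derivable equations that hold for the expectations of continuous functions. -/
def Eqv (t u : Term Δ ℓ) : Prop :=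
  Deriv t u ∧ ∀ G : Space Δ → ℝ, (∀ x, Continuous fun v : Fin (Δ x) → I => G ⟨x, v⟩) →
    sem G t = sem G u

variable (Δ ℓ) in
/-- The setoid of `Eqv`. -/
def eqvSetoid : Setoid (Term Δ ℓ) where
  r := Eqv
  iseqv := ⟨fun t => ⟨.refl t, fun _ _ => rfl⟩, fun h => ⟨h.1.symm, fun G hG => (h.2 G hG).symm⟩,
    fun h h' => ⟨h.1.trans h'.1, fun G hG => (h.2 G hG).trans (h'.2 G hG)⟩⟩

variable (Δ ℓ) in
/-- Classes of terms. -/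
def TermClass : Type := Quotient (eqvSetoid Δ ℓ)

namespace TermClass

/-- The class of a term. -/
def mk (t : Term Δ ℓ) : TermClass Δ ℓ := Quotient.mk (eqvSetoid Δ ℓ) t

theorem mk_eq_mk {t u : Term Δ ℓ} : mk t = mk u ↔ Eqv t u := Quotient.eq (r := eqvSetoid Δ ℓ)

@[elab_as_elim]
theorem ind {p : TermClass Δ ℓ → Prop} (h : ∀ t, p (mk t)) (x : TermClass Δ ℓ) : p x :=
  Quotient.inductionOn x h

/-- The expectation of a continuous function. -/
noncomputable def expect (G : Space Δ → ℝ)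
    (hG : ∀ x, Continuous fun v : Fin (Δ x) → I => G ⟨x, v⟩) :
    TermClass Δ ℓ → (Fin ℓ → I) → ℝ :=
  Quotient.lift (sem G) fun _ _ h => h.2 G hG

/-- The choice `x ?_p y`. -/
def pch (p : Fin ℓ) : TermClass Δ ℓ → TermClass Δ ℓ → TermClass Δ ℓ :=
  Quotient.map₂ (Term.pch p) fun _ _ h _ _ h' =>
    ⟨.pch p h.1 h'.1, fun G hG => by funext r; simp only [sem, h.2 G hG, h'.2 G hG]⟩

/-- `ν_{i+1,j+1} p. x(p)`. -/
def nu (i j : ℕ) : TermClass Δ (ℓ + 1) → TermClass Δ ℓ :=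
  Quotient.map (Term.nu (i + 1) (j + 1) i.succ_pos j.succ_pos) fun _ _ h =>
    ⟨.nu _ _ _ _ h.1, fun G hG => by funext r; simp only [sem, h.2 G hG]⟩

/-- `x _i?_j y`. -/
def rch (i j : ℕ) (h : 0 < i + j) : TermClass Δ ℓ → TermClass Δ ℓ → TermClass Δ ℓ :=
  Quotient.map₂ (Term.rch i j h) fun _ _ h _ _ h' =>
    ⟨.rch i j _ h.1 h'.1, fun G hG => by funext r; simp only [sem, h.2 G hG, h'.2 G hG]⟩

@[simp] theorem pch_mk (p : Fin ℓ) (t u : Term Δ ℓ) : pch p (mk t) (mk u) = mk (.pch p t u) := rfl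

@[simp] theorem nu_mk (i j : ℕ) (t : Term Δ (ℓ + 1)) :
    nu i j (mk t) = mk (.nu (i + 1) (j + 1) i.succ_pos j.succ_pos t) := rfl

@[simp] theorem rch_mk (i j : ℕ) (h : 0 < i + j) (t u : Term Δ ℓ) :
    rch i j h (mk t) (mk u) = mk (.rch i j h t u) := rfl

theorem cast_add_ne_zero {i j : ℕ} (h : 0 < i + j) : (i : ℝ) + (j : ℝ) ≠ 0 := by
  exact_mod_cast h.ne'

noncomputable instance : RationalConvex (TermClass Δ ℓ) where
  -- The value at `i = j = 0` is a default; every law assumes positive total weight.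
  mix i j x y := if h : 0 < i + j then rch i j h x y else x
  mix_mix {i j k l} hij hkl hik hjl w x y z := by
    rw [dif_pos hij, dif_pos hkl, dif_pos hik, dif_pos hjl, dif_pos (Nat.add_pos_left hij _),
      dif_pos (Nat.add_pos_left hik _)]
    induction w using ind with | _ w
    induction x using ind with | _ x
    induction y using ind with | _ y
    induction z using ind with | _ z
    refine mk_eq_mk.2 ⟨Deriv.rch_exchange i j k l hij hkl hik hjl _ _ w x y z, fun G hG => ?_⟩
    funext r
    have h1 := cast_add_ne_zero hij
    have h2 := cast_add_ne_zero hkl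
    have h3 := cast_add_ne_zero hik
    have h4 := cast_add_ne_zero hjl
    have h5 : ((i : ℝ) + j) + (k + l) ≠ 0 := by exact_mod_cast (Nat.add_pos_left hij _).ne'
    have h6 : ((i : ℝ) + k) + (j + l) ≠ 0 := by exact_mod_cast (Nat.add_pos_left hik _).ne'
    simp only [sem, Nat.cast_add]
    rw [mul_div_cancel₀ _ h1, mul_div_cancel₀ _ h2, mul_div_cancel₀ _ h3, mul_div_cancel₀ _ h4,
      div_eq_div_iff h5 h6]
    ring
  mix_comm {i j} h x y := by
    rw [dif_pos h, dif_pos (by omega)]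
    induction x using ind with | _ x
    induction y using ind with | _ y
    refine mk_eq_mk.2 ⟨Deriv.rch_swap i j h _ x y, fun G hG => ?_⟩
    funext r
    simp only [sem]
    rw [add_comm, add_comm (i : ℝ)]
  mix_zero_right {i} h x y := by
    rw [dif_pos (by omega)]
    induction x using ind with | _ x
    induction y using ind with | _ y
    refine mk_eq_mk.2 ⟨Deriv.rch_unit i h x y, fun G hG => ?_⟩
    funext r
    have : (i : ℝ) ≠ 0 := by exact_mod_cast h.ne'
    simp only [sem]
    field_simp
    simp [mul_comm]
  mix_self {i j} h x := by
    rw [dif_pos h]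
    induction x using ind with | _ x
    refine mk_eq_mk.2 ⟨Deriv.rch_idem i j h x, fun G hG => ?_⟩
    funext r
    simp only [sem]
    rw [← add_mul, mul_div_cancel_left₀ _ (cast_add_ne_zero h)]

theorem mix_def {i j : ℕ} (h : 0 < i + j) (x y : TermClass Δ ℓ) :
    RationalConvex.mix i j x y = rch i j h x y := dif_pos h

theorem pch_pch (p q : Fin ℓ) (w x y z : TermClass Δ ℓ) :
    pch p (pch q w x) (pch q y z) = pch q (pch p w y) (pch p x z) := by
  induction w using ind with | _ w
  induction x using ind with | _ x
  induction y using ind with | _ y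
  induction z using ind with | _ z
  refine mk_eq_mk.2 ⟨Deriv.pch_pch p q w x y z, fun G hG => ?_⟩
  funext r
  simp only [sem]
  ring

theorem pch_mix (p : Fin ℓ) {i j : ℕ} (h : 0 < i + j) (w x y z : TermClass Δ ℓ) :
    pch p (RationalConvex.mix i j w x) (RationalConvex.mix i j y z) =
      RationalConvex.mix i j (pch p w y) (pch p x z) := by
  rw [mix_def h, mix_def h, mix_def h]
  induction w using ind with | _ w
  induction x using ind with | _ x
  induction y using ind with | _ y
  induction z using ind with | _ z
  refine mk_eq_mk.2 ⟨Deriv.pch_rch p i j h w x y z, fun G hG => ?_⟩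
  funext r
  simp only [sem]
  ring

theorem pch_self (p : Fin ℓ) (x : TermClass Δ ℓ) : pch p x x = x := by
  induction x using ind with | _ x
  refine mk_eq_mk.2 ⟨Deriv.pch_idem p x, fun G hG => ?_⟩
  funext r
  simp only [sem]
  ring

theorem nu_mix (i j : ℕ) {a b : ℕ} (h : 0 < a + b) (x y : TermClass Δ (ℓ + 1)) :
    nu i j (RationalConvex.mix a b x y) = RationalConvex.mix a b (nu i j x) (nu i j y) := by
  rw [mix_def h, mix_def h]
  induction x using ind with | _ x
  induction y using ind with | _ y
  refine mk_eq_mk.2 ⟨Deriv.nu_rch (i + 1) (j + 1) a b _ _ h x y, fun G hG => ?_⟩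
  funext r
  simp only [sem]
  rw [integral_div, integral_add
    ((integrable_of_continuous (continuous_sem_snoc hG x r)).const_mul _)
    ((integrable_of_continuous (continuous_sem_snoc hG y r)).const_mul _),
    integral_const_mul, integral_const_mul]

theorem nu_pch_castSucc (i j : ℕ) (q : Fin ℓ) (x y : TermClass Δ (ℓ + 1)) :
    nu i j (pch q.castSucc x y) = pch q (nu i j x) (nu i j y) := by
  induction x using ind with | _ x
  induction y using ind with | _ y
  refine mk_eq_mk.2 ⟨Deriv.nu_pch_castSucc (i + 1) (j + 1) _ _ q x y, fun G hG => ?_⟩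
  funext r
  simp only [sem, Fin.snoc_castSucc]
  rw [integral_add
    ((integrable_of_continuous (continuous_sem_snoc hG x r)).const_mul _)
    ((integrable_of_continuous (continuous_sem_snoc hG y r)).const_mul _),
    integral_const_mul, integral_const_mul]

theorem nu_pch_last (i j : ℕ) (x y : TermClass Δ (ℓ + 1)) :
    nu i j (pch (Fin.last ℓ) x y) =
      RationalConvex.mix (i + 1) (j + 1) (nu (i + 1) j x) (nu i (j + 1) y) := by
  rw [mix_def (by omega)]
  induction x using ind with | _ x
  induction y using ind with | _ y
  refine mk_eq_mk.2 ⟨Deriv.nu_pch_last (i + 1) (j + 1) _ _ _ _ (by omega) x y, fun G hG => ?_⟩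
  funext r
  simp only [sem, Fin.snoc_last]
  exact integral_betaI_conj i j (continuous_sem_snoc hG x r) (continuous_sem_snoc hG y r)

/-- Raises the index sum of a `ν` by one, as Bernstein polynomials are rewritten in the next higher
degree. -/
theorem nu_eq_mix (i j : ℕ) (x : TermClass Δ (ℓ + 1)) :
    nu i j x = RationalConvex.mix (i + 1) (j + 1) (nu (i + 1) j x) (nu i (j + 1) x) := by
  rw [← nu_pch_last, pch_self]

theorem nu_const (i j : ℕ) (t : Term Δ ℓ) : nu i j (mk (t.rename Fin.castSucc)) = mk t := by
  refine mk_eq_mk.2 ⟨Deriv.nu_const (i + 1) (j + 1) _ _ t, fun G hG => ?_⟩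
  funext r
  have := isProbabilityMeasure_betaI i.succ_pos j.succ_pos
  have e : ∀ s, (Fin.snoc (α := fun _ => I) r s : Fin (ℓ + 1) → I) ∘ Fin.castSucc = r := fun s => by
    funext q
    simp
  simp only [sem, sem_rename, e]
  simp

theorem nu_nu (i j a b : ℕ) (t : Term Δ (ℓ + 2)) :
    nu i j (nu a b (mk t)) = nu a b (nu i j (mk (t.rename (Term.swapLast ℓ)))) := by
  refine mk_eq_mk.2 ⟨Deriv.nu_nu (i + 1) (j + 1) (a + 1) (b + 1) _ _ _ _ t, fun G hG => ?_⟩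
  funext r
  have e : ∀ s s' : I, (Fin.snoc (α := fun _ => I) (Fin.snoc (α := fun _ => I) r s) s' :
      Fin (ℓ + 2) → I) ∘ Term.swapLast ℓ =
        Fin.snoc (α := fun _ => I) (Fin.snoc (α := fun _ => I) r s') s := fun s s' => by
    funext q
    refine Fin.lastCases ?_ (fun q => Fin.lastCases ?_ (fun q => ?_) q) q <;> simp
  simp only [sem, sem_rename, e]
  -- Soundness of C2 is Fubini for a continuous function on the square.
  refine integral_integral_swap_of_hasCompactSupport
    (f := fun s s' => sem G t (Fin.snoc (α := fun _ => I) (Fin.snoc (α := fun _ => I) r s) s'))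
    ?_ (HasCompactSupport.of_compactSpace _)
  exact (continuous_sem hG t).comp ((continuous_snoc (ℓ + 1)).comp
    (((continuous_snoc ℓ).comp (continuous_const.prodMk continuous_fst)).prodMk continuous_snd))

end TermClass

end Classes

/-! ### Trees of parameter choices -/

section Tree

variable {k : ℕ} {Δ : Fin k → ℕ} {ℓ : ℕ}

open TermClass

/-- The full tree of choices on the parameters of a list, whose leaves only depend on how often each
parameter has come up. -/
noncomputable def tree : List (Fin ℓ) → ((Fin ℓ →₀ ℕ) → TermClass Δ ℓ) → TermClass Δ ℓ
  | [], g => g 0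
  | p :: w, g => pch p (tree w fun e => g (e + Finsupp.single p 1)) (tree w g)

theorem tree_congr (w : List (Fin ℓ)) {g g' : (Fin ℓ →₀ ℕ) → TermClass Δ ℓ}
    (h : ∀ e : Fin ℓ →₀ ℕ, (∀ q, e q ≤ w.count q) → g e = g' e) : tree w g = tree w g' := by
  induction w generalizing g g' with
  | nil => exact h 0 fun q => Nat.zero_le _
  | cons p w ih =>
    rw [tree, tree]
    refine congrArg₂ _ (ih fun e he => h _ fun q => ?_) (ih fun e he => h _ fun q => ?_)
    · rw [Finsupp.add_apply, Finsupp.single_apply, List.count_cons]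
      simpa using he q
    · exact (he q).trans List.count_le_count_cons

theorem tree_perm {w w' : List (Fin ℓ)} (h : w.Perm w') (g : (Fin ℓ →₀ ℕ) → TermClass Δ ℓ) :
    tree w g = tree w' g := by
  induction h generalizing g with
  | nil => rfl
  | cons p _ ih => rw [tree, tree, ih, ih]
  | swap p q w =>
    simp only [tree]
    rw [pch_pch]
    simp only [add_right_comm]
  | trans _ _ ih ih' => rw [ih, ih']

theorem tree_mix (w : List (Fin ℓ)) {i j : ℕ} (h : 0 < i + j)
    (g g' : (Fin ℓ →₀ ℕ) → TermClass Δ ℓ) :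
    tree w (fun e => RationalConvex.mix i j (g e) (g' e)) =
      RationalConvex.mix i j (tree w g) (tree w g') := by
  induction w generalizing g g' with
  | nil => rfl
  | cons p w ih => rw [tree, ih, ih, pch_mix p h, tree, tree]

/-- Given that `p` came up `e p` times in `w.count p + 1` exchangeable tosses, the first toss came
up with probability `e p / (w.count p + 1)`. So the leaf `h e` mixes the leaves of the two branches
in this proportion, and no longer depends on the order. -/
theorem pch_tree (p : Fin ℓ) (w : List (Fin ℓ)) (g g' h : (Fin ℓ →₀ ℕ) → TermClass Δ ℓ)
    (hh : ∀ e : Fin ℓ →₀ ℕ, e p ≤ w.count p + 1 → (w.count p + 1) • toCone (h e) =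
      e p • toCone (g (e - Finsupp.single p 1)) + (w.count p + 1 - e p) • toCone (g' e)) :
    pch p (tree w g) (tree w g') = tree (p :: w) h := by
  induction w generalizing g g' h with
  | nil =>
    simp only [tree]
    congr 1
    · have := hh (Finsupp.single p 1) (by simp)
      rw [zero_add]
      refine nsmul_toCone_injective one_pos ?_
      simpa using this.symm
    · refine nsmul_toCone_injective one_pos ?_
      simpa using (hh 0 (by simp)).symm
  | cons q w ih =>
    by_cases hqp : q = p
    · subst hqp
      simp only [List.count_cons_self] at hh
      set c := w.count q with hc
      have key : ∀ a b : (Fin ℓ →₀ ℕ) → TermClass Δ ℓ, ∃ f : (Fin ℓ →₀ ℕ) → TermClass Δ ℓ,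
          (∀ e : Fin ℓ →₀ ℕ, e q ≤ c + 1 → (c + 1) • toCone (f e) =
            e q • toCone (a (e - Finsupp.single q 1)) + (c + 1 - e q) • toCone (b e)) := by
        intro a b
        refine ⟨fun e => RationalConvex.mix (e q) (c + 1 - e q) (a (e - Finsupp.single q 1)) (b e),
          fun e he => ?_⟩
        rw [← toCone_mix (by omega), Nat.add_sub_cancel' he]
      obtain ⟨f₁, hf₁⟩ := key (fun e => g (e + Finsupp.single q 1))
        (fun e => g' (e + Finsupp.single q 1))
      obtain ⟨f₀, hf₀⟩ := key g g'
      -- C1 with both parameters equal to `q` exchanges the first two tosses, and induction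
      -- symmetrizes the lower ones. This is a second expression for the same element.
      have e₁ : pch q (tree (q :: w) g) (tree (q :: w) g') =
          pch q (tree (q :: w) f₁) (tree (q :: w) f₀) := by
        rw [← ih (fun e => g (e + Finsupp.single q 1)) (fun e => g' (e + Finsupp.single q 1)) f₁ hf₁,
          ← ih _ _ f₀ hf₀, tree, tree, pch_pch]
      have hpos : 0 < 1 + (c + 1) := by omega
      -- The two expressions are averaged with weights `1 : c + 1`: of the `c + 2` tosses on `q`,
      -- the first is kept once and one of the other `c + 1` takes its place.
      rw [← RationalConvex.mix_self hpos (pch q (tree (q :: w) g) (tree (q :: w) g'))]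
      nth_rewrite 2 [e₁]
      rw [← pch_mix q hpos, ← tree_mix _ hpos, ← tree_mix _ hpos, tree.eq_2 h q (q :: w)]
      refine congrArg₂ _ (tree_congr _ fun e he => ?_) (tree_congr _ fun e he => ?_)
      · have heq : e q ≤ c + 1 := by simpa [hc] using he q
        refine nsmul_toCone_injective hpos ?_
        rw [toCone_mix hpos, hf₁ e heq, add_comm 1 (c + 1), hh _ (by simpa using heq)]
        simp only [Finsupp.add_apply, Finsupp.single_eq_same, add_tsub_cancel_right]
        have e2 : c + 1 + 1 - (e q + 1) = c + 1 - e q := by omega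
        rw [e2, ← add_assoc, add_nsmul (toCone (g e)) (e q) 1, add_comm (e q • _)]
        congr 2
        -- For `e q = 0` the truncated subtraction cannot be undone, but its term has coefficient
        -- zero.
        rcases Nat.eq_zero_or_pos (e q) with h0 | h0
        · simp [h0]
        · rw [tsub_add_cancel_of_le]
          rwa [Finsupp.single_le_iff]
      · have heq : e q ≤ c + 1 := by simpa [hc] using he q
        refine nsmul_toCone_injective hpos ?_
        rw [toCone_mix hpos, hf₀ e heq, add_comm 1 (c + 1), hh _ (by omega)]
        have e2 : c + 1 + 1 - e q = 1 + (c + 1 - e q) := by omega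
        rw [e2, add_nsmul _ 1]
        abel
    · have hcount : (q :: w).count p = w.count p := List.count_cons_of_ne hqp
      rw [hcount] at hh
      have ih' := ih (fun e => g (e + Finsupp.single q 1)) (fun e => g' (e + Finsupp.single q 1))
        (fun e => h (e + Finsupp.single q 1)) fun e he => ?_
      · rw [tree, tree, pch_pch, ih g g' h hh, ih', tree_perm (List.Perm.swap q p w) h]
        simp only [tree]
      have hq : (e + Finsupp.single q 1 : Fin ℓ →₀ ℕ) p = e p := by
        simp [hqp]
      have := hh (e + Finsupp.single q 1) (by rwa [hq])
      rw [hq] at this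
      rw [this]
      congr 4
      ext a
      simp only [Finsupp.coe_tsub, Finsupp.coe_add, Pi.sub_apply, Pi.add_apply,
        Finsupp.single_apply]
      split_ifs <;> omega

end Tree

/-! ### Chains of beta distributions -/

/-- Canonical descriptions of the terms `ν p₁ … ν p_b. x(q₁, …, q_m)` whose `ν` all have indices
with sum `N + 2`: each argument is either a parameter that is already available, or it is bound
by a `ν` in front of it. -/
def Chain (N : ℕ) : ℕ → ℕ → Type
  | _, 0 => Unit
  | ℓ, m + 1 => (Fin ℓ × Chain N ℓ m) ⊕ (Fin (N + 1) × Chain N (ℓ + 1) m)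

namespace Chain

open Term

variable {k : ℕ} {Δ : Fin k → ℕ} {N : ℕ}

instance instFintype : (ℓ m : ℕ) → Fintype (Chain N ℓ m)
  | _, 0 => inferInstanceAs (Fintype Unit)
  | ℓ, m + 1 =>
    have := instFintype (ℓ := ℓ) (m := m)
    have := instFintype (ℓ := ℓ + 1) (m := m)
    inferInstanceAs (Fintype ((Fin ℓ × Chain N ℓ m) ⊕ (Fin (N + 1) × Chain N (ℓ + 1) m)))

instance instDecidableEq : (ℓ m : ℕ) → DecidableEq (Chain N ℓ m)
  | _, 0 => inferInstanceAs (DecidableEq Unit)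
  | ℓ, m + 1 =>
    have := instDecidableEq (ℓ := ℓ) (m := m)
    have := instDecidableEq (ℓ := ℓ + 1) (m := m)
    inferInstanceAs (DecidableEq ((Fin ℓ × Chain N ℓ m) ⊕ (Fin (N + 1) × Chain N (ℓ + 1) m)))

/-- Renaming of parameters. -/
def rename : {ℓ ℓ' m : ℕ} → (Fin ℓ → Fin ℓ') → Chain N ℓ m → Chain N ℓ' m
  | _, _, 0, _, _ => ()
  | _, _, _ + 1, ρ, .inl (q, L) => .inl (ρ q, rename ρ L)
  | _, _, _ + 1, ρ, .inr (i, L) => .inr (i, rename (lift ρ) L)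

/-- The term described by a chain, where the first `a` arguments of the variable are given. -/
def toTerm (x : Fin k) : {ℓ a m : ℕ} → a + m = Δ x → (Fin a → Fin ℓ) → Chain N ℓ m → Term Δ ℓ
  | _, _, 0, h, f, _ => .var x fun c => f (Fin.cast h.symm c)
  | ℓ, _, _ + 1, h, f, .inl (q, L) =>
    toTerm x (by omega) (Fin.snoc (α := fun _ => Fin ℓ) f q) L
  | ℓ, _, _ + 1, h, f, .inr (i, L) =>
    .nu (i + 1) (N - i + 1) (Nat.succ_pos _) (Nat.succ_pos _)
      (toTerm x (by omega)
        (Fin.snoc (α := fun _ => Fin (ℓ + 1)) (fun c => (f c).castSucc) (Fin.last ℓ)) L)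

theorem rename_toTerm (x : Fin k) {ℓ ℓ' a m : ℕ} (h : a + m = Δ x) (f : Fin a → Fin ℓ)
    (ρ : Fin ℓ → Fin ℓ') (L : Chain N ℓ m) :
    (toTerm x h f L).rename ρ = toTerm x h (ρ ∘ f) (L.rename ρ) := by
  induction m generalizing ℓ ℓ' a with
  | zero => rfl
  | succ m ih =>
    rcases L with ⟨q, L⟩ | ⟨i, L⟩
    · simp only [toTerm, rename, ih]
      congr 1
      funext c
      refine Fin.lastCases ?_ (fun c => ?_) c <;> simp
    · simp only [toTerm, rename, Term.rename, ih]
      congr 2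
      funext c
      refine Fin.lastCases ?_ (fun c => ?_) c <;> simp

theorem exists_toTerm_eq_var (x : Fin k) {ℓ a m : ℕ} (h : a + m = Δ x)
    (f : Fin (Δ x) → Fin ℓ) :
    ∃ L : Chain N ℓ m, toTerm x h (fun c => f (Fin.castLE (by omega) c)) L = .var x f := by
  induction m generalizing a with
  | zero => exact ⟨(), rfl⟩
  | succ m ih =>
    obtain ⟨L, hL⟩ := ih (a := a + 1) (by omega)
    refine ⟨.inl (f ⟨a, by omega⟩, L), ?_⟩
    rw [← hL, toTerm]
    congr 1
    funext c
    refine Fin.lastCases ?_ (fun c => ?_) c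
    · rw [Fin.snoc_last]
      rfl
    · rw [Fin.snoc_castSucc]
      rfl

/-- The `ν` travels inwards to the first use of its parameter. If there is none, D1 removes it. The
embedding of `f` by `castSucc` records that the arguments already given do not use it. -/
theorem exists_nu_toTerm (x : Fin k) {ℓ a m : ℕ} (h : a + m = Δ x) (f : Fin a → Fin ℓ)
    (i : Fin (N + 1)) (L : Chain N (ℓ + 1) m) :
    ∃ L' : Chain N ℓ m, TermClass.nu i (N - i)
      (TermClass.mk (toTerm x h (fun c => (f c).castSucc) L)) =
        TermClass.mk (toTerm x h f L') := by
  induction m generalizing ℓ a with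
  | zero => 
    refine ⟨(), ?_⟩
    exact TermClass.nu_const i (N - i) (toTerm (N := N) x h f ())
  | succ m ih =>
    rcases L with ⟨q, L⟩ | ⟨j, L⟩
    · revert q
      refine Fin.lastCases ?_ fun q => ?_
      · exact ⟨.inr (i, L), rfl⟩
      · obtain ⟨L', hL'⟩ := ih (by omega) (Fin.snoc (α := fun _ => Fin ℓ) f q) L
        refine ⟨.inl (q, L'), ?_⟩
        rw [toTerm, toTerm, ← hL']
        congr 3
        funext c
        refine Fin.lastCases ?_ (fun c => ?_) c <;> simp
    -- The next argument is bound by another `ν`; C2 moves that one outside, which transposes the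
    -- last two parameters.
    · obtain ⟨L', hL'⟩ := ih (ℓ := ℓ + 1) (a := a + 1) (by omega)
        (Fin.snoc (α := fun _ => Fin (ℓ + 1)) (fun c => (f c).castSucc) (Fin.last ℓ))
        (L.rename (swapLast ℓ))
      refine ⟨.inr (j, L'), ?_⟩
      rw [toTerm, toTerm, ← TermClass.nu_mk, ← TermClass.nu_mk, ← hL', TermClass.nu_nu,
        rename_toTerm]
      congr 4
      funext c
      refine Fin.lastCases ?_ (fun c => ?_) c <;> simp

end Chain

/-! ### Normal forms -/

section NormalForm

variable {k : ℕ} {Δ : Fin k → ℕ} {ℓ : ℕ} {N : ℕ}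

open TermClass

/-- The class of the term described by a chain. -/
def chainClass (L : Σ x : Fin k, Chain N ℓ (Δ x)) : TermClass Δ ℓ :=
  mk (Chain.toTerm (a := 0) L.1 (Nat.zero_add _) Fin.elim0 L.2)

variable (N) in
/-- Averages of chains. -/
def IsChainAverage (y : TermClass Δ ℓ) : Prop :=
  ∃ S : Multiset (Σ x : Fin k, Chain N ℓ (Δ x)), IsAverage (S.map chainClass) y

theorem IsChainAverage.mix {x y : TermClass Δ ℓ} (hx : IsChainAverage N x)
    (hy : IsChainAverage N y) {i j : ℕ} (h : 0 < i + j) :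
    IsChainAverage N (RationalConvex.mix i j x y) := by
  obtain ⟨S, hS⟩ := hx
  obtain ⟨T, hT⟩ := hy
  refine ⟨(i * T.card) • S + (j * S.card) • T, ?_⟩
  simpa [Multiset.map_add, Multiset.map_nsmul] using hS.mix hT h

theorem isChainAverage_var (x : Fin k) (p : Fin (Δ x) → Fin ℓ) :
    IsChainAverage N (mk (.var x p)) := by
  obtain ⟨L, hL⟩ := Chain.exists_toTerm_eq_var (N := N) x (Nat.zero_add _) p
  refine ⟨{⟨x, L⟩}, ?_⟩
  rw [← hL, Multiset.map_singleton, chainClass]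
  convert! IsAverage.singleton _ using 4

theorem IsChainAverage.nu_of_add_eq {y : TermClass Δ (ℓ + 1)} (hy : IsChainAverage N y)
    (i : Fin (N + 1)) : IsChainAverage N (nu i (N - i) y) := by
  obtain ⟨S, hS⟩ := hy
  have h : ∀ L : Σ x : Fin k, Chain N (ℓ + 1) (Δ x), ∃ L' : Σ x : Fin k, Chain N ℓ (Δ x),
      nu i (N - i) (chainClass L) = chainClass L' := fun L => by
    obtain ⟨L', hL'⟩ := Chain.exists_nu_toTerm L.1 (Nat.zero_add _) Fin.elim0 i L.2
    refine ⟨⟨L.1, L'⟩, ?_⟩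
    rw [chainClass, chainClass, ← hL']
    congr 3
    funext c
    exact c.elim0
  choose φ hφ using h
  refine ⟨S.map φ, ?_⟩
  convert! hS.map (f := nu i (N - i)) (fun _ _ _ _ h => nu_mix _ _ h _ _) using 1
  rw [Multiset.map_map, Multiset.map_map]
  exact Multiset.map_congr rfl fun L _ => (hφ L).symm

theorem IsChainAverage.nu {y : TermClass Δ (ℓ + 1)} (hy : IsChainAverage N y) (i j : ℕ)
    (h : i + j ≤ N) : IsChainAverage N (nu i j y) := by
  obtain ⟨d, rfl⟩ := Nat.exists_eq_add_of_le h
  -- The deficit `d` of the index sum is reduced by one with each use of `nu_eq_mix`.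
  induction d generalizing i j with
  | zero => simpa using hy.nu_of_add_eq ⟨i, by omega⟩
  | succ d ih =>
    rw [nu_eq_mix]
    have e₁ : i + j + (d + 1) = i + 1 + j + d := by omega
    have e₂ : i + j + (d + 1) = i + (j + 1) + d := by omega
    refine IsChainAverage.mix ?_ ?_ (by omega)
    · rw [e₁] at hy ⊢
      exact ih _ _ hy (by omega)
    · rw [e₂] at hy ⊢
      exact ih _ _ hy (by omega)

variable (N) in
/-- Trees over `w` of averages of chains. -/
def IsNormal (w : List (Fin ℓ)) (y : TermClass Δ ℓ) : Prop :=
  ∃ g : (Fin ℓ →₀ ℕ) → TermClass Δ ℓ, (∀ e, IsChainAverage N (g e)) ∧ y = tree w g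

theorem IsNormal.pch {w : List (Fin ℓ)} {x y : TermClass Δ ℓ} (hx : IsNormal N w x)
    (hy : IsNormal N w y) (p : Fin ℓ) : IsNormal N (p :: w) (pch p x y) := by
  obtain ⟨g, hg, rfl⟩ := hx
  obtain ⟨g', hg', rfl⟩ := hy
  refine ⟨fun e => RationalConvex.mix (e p) (w.count p + 1 - e p)
    (g (e - Finsupp.single p 1)) (g' e), fun e => (hg _).mix (hg' _) (by omega),
    pch_tree p w g g' _ fun e he => ?_⟩
  rw [← toCone_mix (by omega), Nat.add_sub_cancel' he]

theorem IsNormal.perm {w w' : List (Fin ℓ)} {x : TermClass Δ ℓ} (hx : IsNormal N w x)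
    (h : w.Perm w') : IsNormal N w' x := by
  obtain ⟨g, hg, rfl⟩ := hx
  exact ⟨g, hg, tree_perm h g⟩

/-- By D2 a redundant choice can always be put on top; this is how two terms acquire a common list.
-/
theorem IsNormal.append_left {w : List (Fin ℓ)} {x : TermClass Δ ℓ} (hx : IsNormal N w x)
    (v : List (Fin ℓ)) : IsNormal N (v ++ w) x := by
  induction v with
  | nil => exact hx
  | cons p v ih =>
    rw [← pch_self p x]
    exact ih.pch ih p

theorem IsNormal.append_right {w : List (Fin ℓ)} {x : TermClass Δ ℓ} (hx : IsNormal N w x)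
    (v : List (Fin ℓ)) : IsNormal N (w ++ v) x :=
  (hx.append_left v).perm List.perm_append_comm

theorem IsNormal.mix {w : List (Fin ℓ)} {x y : TermClass Δ ℓ} (hx : IsNormal N w x)
    (hy : IsNormal N w y) {i j : ℕ} (h : 0 < i + j) :
    IsNormal N w (RationalConvex.mix i j x y) := by
  obtain ⟨g, hg, rfl⟩ := hx
  obtain ⟨g', hg', rfl⟩ := hy
  exact ⟨_, fun e => (hg e).mix (hg' e) h, (tree_mix w h g g').symm⟩

/-- The list `w'` is `w` without the bound parameter. It is chosen before `N`, `i`, `j` and `g`,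
because the branches have different indices and leaves but must share a list. Each choice absorbed
by Conj raises the index sum by one, whence the bound with `w.length`. -/
theorem exists_isNormal_nu_tree (w : List (Fin (ℓ + 1))) :
    ∃ w' : List (Fin ℓ), ∀ (N i j : ℕ) (g : (Fin (ℓ + 1) →₀ ℕ) → TermClass Δ (ℓ + 1)),
      i + j + w.length ≤ N → (∀ e, IsChainAverage N (g e)) →
        IsNormal N w' (TermClass.nu i j (tree w g)) := by
  induction w with
  | nil => exact ⟨[], fun N i j g h hg => ⟨fun _ => TermClass.nu i j (g 0),
      fun _ => (hg 0).nu i j h, rfl⟩⟩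
  | cons p w ih =>
    obtain ⟨w', hw'⟩ := ih
    revert p
    refine Fin.lastCases ?_ fun q => ?_
    · refine ⟨w', fun N i j g h hg => ?_⟩
      rw [List.length_cons] at h
      rw [tree, nu_pch_last]
      exact (hw' N _ _ _ (by omega) fun e => hg _).mix (hw' N _ _ _ (by omega) hg) (by omega)
    · refine ⟨q :: w', fun N i j g h hg => ?_⟩
      rw [List.length_cons] at h
      rw [tree, nu_pch_castSucc]
      exact (hw' N _ _ _ (by omega) fun e => hg _).pch (hw' N _ _ _ (by omega) hg) q

theorem exists_isNormal (t : Term Δ ℓ) :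
    ∃ (N₀ : ℕ) (w : List (Fin ℓ)), ∀ N ≥ N₀, IsNormal N w (mk t) := by
  induction t with
  | var x p => exact ⟨0, [], fun N _ => ⟨fun _ => mk (.var x p),
      fun _ => isChainAverage_var x p, rfl⟩⟩
  | nu i j hi hj t ih =>
    obtain ⟨N₀, w, hw⟩ := ih
    obtain ⟨w', hw'⟩ := exists_isNormal_nu_tree (Δ := Δ) w
    obtain ⟨i, rfl⟩ := Nat.exists_eq_succ_of_ne_zero hi.ne'
    obtain ⟨j, rfl⟩ := Nat.exists_eq_succ_of_ne_zero hj.ne'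
    refine ⟨max N₀ (i + j + w.length), w', fun N hN => ?_⟩
    obtain ⟨g, hg, e⟩ := hw N ((le_max_left _ _).trans hN)
    have := hw' N i j g ((le_max_right _ _).trans hN) hg
    rwa [← e] at this
  | pch p t u iht ihu =>
    obtain ⟨N₁, w₁, h₁⟩ := iht
    obtain ⟨N₂, w₂, h₂⟩ := ihu
    exact ⟨max N₁ N₂, p :: (w₁ ++ w₂), fun N hN =>
      ((h₁ N ((le_max_left _ _).trans hN)).append_right w₂).pch
        ((h₂ N ((le_max_right _ _).trans hN)).append_left w₁) p⟩
  | rch i j h t u iht ihu =>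
    obtain ⟨N₁, w₁, h₁⟩ := iht
    obtain ⟨N₂, w₂, h₂⟩ := ihu
    refine ⟨max N₁ N₂, w₁ ++ w₂, fun N hN => ?_⟩
    rw [← rch_mk, ← mix_def]
    exact ((h₁ N ((le_max_left _ _).trans hN)).append_right w₂).mix
        ((h₂ N ((le_max_right _ _).trans hN)).append_left w₁) h

end NormalForm

/-! ### Linear independence of chains -/

/-- The point of the unit interval with odds `u`. -/
noncomputable def ofOdds (u : ℝ) (hu : 0 < u) : I :=
  ⟨u / (1 + u), by positivity, by rw [div_le_one (by positivity)]; linarith⟩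

theorem coe_ofOdds (u : ℝ) (hu : 0 < u) : (ofOdds u hu : ℝ) = u / (1 + u) := rfl

theorem one_sub_ofOdds (u : ℝ) (hu : 0 < u) : 1 - (ofOdds u hu : ℝ) = 1 / (1 + u) := by
  rw [coe_ofOdds]
  field_simp
  ring

theorem odds_ofOdds (u : ℝ) (hu : 0 < u) :
    (ofOdds u hu : ℝ) / (1 - (ofOdds u hu : ℝ)) = u := by
  rw [one_sub_ofOdds, coe_ofOdds]
  field_simp

/-- In the odds `u = s / (1 - s)` the weight of index `i` is `u ^ i / (1 + u) ^ N`, so the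
combination becomes a polynomial in `u` with infinitely many roots. -/
theorem eq_zero_of_sum_betaWeight_eq_zero {N : ℕ} (a : Fin (N + 1) → ℝ) {S : Set I}
    (hS : S.Finite) (h : ∀ s ∉ S, ∑ i, a i * betaWeight i (N - i) s = 0) : a = 0 := by
  let P : Polynomial ℝ := ∑ i : Fin (N + 1), Polynomial.C (a i) * Polynomial.X ^ (i : ℕ)
  have hP : P = 0 := by
    refine Polynomial.eq_zero_of_infinite_isRoot P
      (((Set.Ioi_infinite (0 : ℝ)).sdiff
        (hS.image fun s : I => (s : ℝ) / (1 - (s : ℝ)))).mono ?_)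
    rintro u ⟨hu, huS⟩
    have hu : 0 < u := hu
    have hs : ofOdds u hu ∉ S := fun hs => huS ⟨_, hs, odds_ofOdds u hu⟩
    have hw : ∀ i : Fin (N + 1), u ^ (i : ℕ) =
        (1 + u) ^ N * betaWeight i (N - i) (ofOdds u hu) := fun i => by
      have hi : (1 + u) ^ N = (1 + u) ^ (i : ℕ) * (1 + u) ^ (N - i) := by
        rw [← pow_add, Nat.add_sub_cancel' (by omega)]
      rw [betaWeight, one_sub_ofOdds, coe_ofOdds, hi, div_pow, div_pow, one_pow]
      field_simp
    simp only [Set.mem_ofPred_eq, Polynomial.IsRoot, P, Polynomial.eval_finsetSum,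
      Polynomial.eval_mul, Polynomial.eval_C, Polynomial.eval_pow, Polynomial.eval_X]
    calc ∑ i, a i * u ^ (i : ℕ)
        = (1 + u) ^ N * ∑ i, a i * betaWeight i (N - i) (ofOdds u hu) := by
          rw [Finset.mul_sum]
          exact Finset.sum_congr rfl fun i _ => by rw [hw]; ring
      _ = 0 := by rw [h _ hs, mul_zero]
  funext i
  have := congrArg (fun Q => Polynomial.coeff Q i) hP
  simpa [P, Polynomial.finsetSum_coeff, Polynomial.coeff_X_pow, Fin.val_inj] using this

namespace Chain

variable {N : ℕ}

/-- The expectation of a product function under the interpretation of a chain. -/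
noncomputable def expect :
    {ℓ m : ℕ} → (ℕ → I → ℝ) → Chain N ℓ m → (Fin ℓ → I) → ℝ
  | _, 0, _, _, _ => 1
  | _, _ + 1, F, .inl (q, L), r => F 0 (r q) * expect (fun c => F (c + 1)) L r
  | _, _ + 1, F, .inr (i, L), r =>
    ∫ s, F 0 s * expect (fun c => F (c + 1)) L (Fin.snoc (α := fun _ => I) r s)
      ∂betaI (i + 1) (N - i + 1)

theorem continuous_expect {ℓ m : ℕ} {F : ℕ → I → ℝ} (hF : ∀ n, Continuous (F n))
    (L : Chain N ℓ m) : Continuous (expect F L) := by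
  induction m generalizing ℓ F with
  | zero => exact continuous_const
  | succ m ih =>
    rcases L with ⟨q, L⟩ | ⟨i, L⟩
    · exact ((hF 0).comp (continuous_apply q)).mul (ih (fun n => hF (n + 1)) L)
    · exact continuous_integral_betaI i (N - i) (((hF 0).comp continuous_snd).mul
        ((ih (fun n => hF (n + 1)) L).comp (continuous_snoc _)))

theorem continuous_expect_snoc {ℓ m : ℕ} {F : ℕ → I → ℝ} (hF : ∀ n, Continuous (F n))
    (L : Chain N (ℓ + 1) m) (r : Fin ℓ → I) :
    Continuous fun s => expect F L (Fin.snoc (α := fun _ => I) r s) :=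
  (continuous_expect hF L).comp
    ((continuous_snoc ℓ).comp (by fun_prop : Continuous fun s => (r, s)))

theorem eq_zero_of_dirac_add_density {ℓ : ℕ} {r : Fin ℓ → I} (hr : Function.Injective r)
    {A : Fin ℓ → ℝ} {φ : I → ℝ} (hφ : Continuous φ)
    (h : ∀ f : I → ℝ, Continuous f → ∑ q, f (r q) * A q + ∫ s, f s * φ s = 0) :
    (∀ q, A q = 0) ∧ ∀ s ∉ Set.range r, φ s = 0 := by
  have hcont : ∀ q, Continuous fun s : I => (s : ℝ) - r q := fun q => by fun_prop
  have h0 : (fun s => (φ s * ∏ q, ((s : ℝ) - r q)) ^ 2) = 0 := by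
    -- The test function `φ ∏ (s - r q)²` kills the atoms and leaves the integral of a square.
    have hc : Continuous fun s : I => φ s * ∏ q, ((s : ℝ) - r q) ^ 2 :=
      hφ.mul (continuous_finsetProd _ fun q _ => (hcont q).pow 2)
    have hc' : Continuous fun s : I => (φ s * ∏ q, ((s : ℝ) - r q)) ^ 2 :=
      (hφ.mul (continuous_finsetProd _ fun q _ => hcont q)).pow 2
    have h1 := h _ hc
    rw [Finset.sum_eq_zero fun q _ => ?_, zero_add] at h1
    · have h2 : ∫ s, (φ s * ∏ q, ((s : ℝ) - r q)) ^ 2 = 0 := by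
        rw [← h1]
        congr 1
        funext s
        rw [Finset.prod_pow]
        ring
      rw [integral_eq_zero_iff_of_nonneg (fun s => sq_nonneg _)
        (integrable_of_continuous hc')] at h2
      exact (Continuous.ae_eq_iff_eq volume hc' continuous_zero).1 h2
    · rw [Finset.prod_eq_zero (Finset.mem_univ q) (by simp)]
      simp
  have h1 : ∀ s ∉ Set.range r, φ s = 0 := fun s hs => by
    have := congrFun h0 s
    simp only [Pi.zero_apply, pow_eq_zero_iff two_ne_zero, mul_eq_zero,
      Finset.prod_eq_zero_iff] at this
    refine this.resolve_right ?_
    rintro ⟨q, -, hq⟩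
    exact hs ⟨q, (Subtype.ext (sub_eq_zero.1 hq)).symm⟩
  refine ⟨fun q => ?_, h1⟩
  -- With the density gone almost everywhere, the product over the other points isolates the atom at
  -- `r q`.
  have h2 := h (fun s => ∏ q' ∈ Finset.univ.erase q, ((s : ℝ) - r q'))
    (continuous_finsetProd _ fun q _ => hcont q)
  have h3 : ∫ s : I, (∏ q' ∈ Finset.univ.erase q, ((s : ℝ) - r q')) * φ s = 0 := by
    refine integral_eq_zero_of_ae ?_
    have hfin : (volume : Measure I) (Set.range r) = 0 := (Set.finite_range r).measure_zero _
    filter_upwards [measure_eq_zero_iff_ae_notMem.1 hfin] with s hs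
    simp [h1 s hs]
  rw [h3, add_zero, Finset.sum_eq_single q, mul_eq_zero] at h2
  · refine h2.resolve_left (Finset.prod_ne_zero_iff.2 fun q' hq' h4 => ?_)
    exact (Finset.ne_of_mem_erase hq') (hr (Subtype.ext (sub_eq_zero.1 h4))).symm
  · intro q' _ hq'
    rw [Finset.prod_eq_zero (Finset.mem_erase.2 ⟨hq', Finset.mem_univ q'⟩) (sub_self _), zero_mul]
  · simp

theorem injective_snoc {ℓ : ℕ} {r : Fin ℓ → I} (hr : Function.Injective r) {s : I}
    (hs : s ∉ Set.range r) :
    Function.Injective (Fin.snoc (α := fun _ => I) r s : Fin (ℓ + 1) → I) :=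
  Fin.snoc_injective_iff.2 ⟨hr, hs⟩

/-- Induction on the number of arguments. As a functional of the test function for the first
argument, the sum has atoms at the points `r q` and a density; both vanish. The atoms fall under
induction at once. The density does so at each fresh point `s`, and the Bernstein basis then
separates the indices `i`. -/
theorem eq_zero_of_sum_expect_eq_zero {ℓ m : ℕ} {r : Fin ℓ → I} (hr : Function.Injective r)
    (c : Chain N ℓ m → ℝ)
    (h : ∀ F : ℕ → I → ℝ, (∀ n, Continuous (F n)) → ∑ L, c L * expect F L r = 0) :
    ∀ L, c L = 0 := by
  induction m generalizing ℓ with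
  | zero =>
    intro L
    have := h (fun _ _ => 1) fun _ => continuous_const
    have e : ∑ L : Chain N ℓ 0, c L * expect (fun _ _ => 1) L r = c L * 1 :=
      Fintype.sum_unique (ι := Unit) fun L => c L * 1
    rwa [e, mul_one] at this
  | succ m ih =>
    let B : Fin (N + 1) → ℝ := fun i => beta ((i : ℕ) + 1 : ℕ) (N - i + 1 : ℕ)
    have hB : ∀ i, B i ≠ 0 := fun i => (beta_pos (by positivity) (by positivity)).ne'
    let a : (ℕ → I → ℝ) → Fin ℓ → ℝ := fun F q => ∑ L, c (.inl (q, L)) * expect F L r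
    let φ : (ℕ → I → ℝ) → I → ℝ := fun F s => ∑ L, (∑ i : Fin (N + 1),
      c (.inr (i, L)) / B i * betaWeight i (N - i) s) *
        expect F L (Fin.snoc (α := fun _ => I) r s)
    have hφ : ∀ F : ℕ → I → ℝ, (∀ n, Continuous (F n)) → Continuous (φ F) := fun F hF =>
      continuous_finsetSum _ fun L _ => (continuous_finsetSum _ fun i _ =>
        continuous_const.mul (continuous_betaWeight _ _)).mul (continuous_expect_snoc hF L r)
    have key : ∀ F : ℕ → I → ℝ, (∀ n, Continuous (F n)) → ∀ f : I → ℝ, Continuous f →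
        ∑ q, f (r q) * a F q + ∫ s, f s * φ F s = 0 := by
      intro F hF f hf
      have h1 := h (fun n => Nat.casesOn n f F) fun n => by cases n; exacts [hf, hF _]
      rw [← h1]
      have h2 : ∑ L : Chain N ℓ (m + 1), c L * expect (fun n => Nat.casesOn n f F) L r =
          ∑ q, ∑ L, c (.inl (q, L)) * (f (r q) * expect F L r) +
          ∑ i : Fin (N + 1), ∑ L, c (.inr (i, L)) *
            ∫ s, f s * expect F L (Fin.snoc (α := fun _ => I) r s)
              ∂betaI (i + 1) (N - i + 1) := by
        rw [← Fintype.sum_prod_type', ← Fintype.sum_prod_type']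
        exact Fintype.sum_sum_type (α₁ := Fin ℓ × Chain N ℓ m)
          (α₂ := Fin (N + 1) × Chain N (ℓ + 1) m) _
      rw [h2]
      congr 1
      · refine Finset.sum_congr rfl fun q _ => ?_
        rw [Finset.mul_sum]
        exact Finset.sum_congr rfl fun L _ => by ring
      · have h3 : ∀ s, f s * φ F s = ∑ i : Fin (N + 1), ∑ L, c (.inr (i, L)) / B i *
            (betaWeight i (N - i) s * (f s * expect F L (Fin.snoc (α := fun _ => I) r s))) := by
          intro s
          simp only [φ]
          rw [Finset.sum_comm, Finset.mul_sum]
          refine Finset.sum_congr rfl fun L _ => ?_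
          rw [Finset.sum_mul, Finset.mul_sum]
          exact Finset.sum_congr rfl fun i _ => by ring
        have hint : ∀ (i : Fin (N + 1)) (L : Chain N (ℓ + 1) m), Integrable fun s : I =>
            c (.inr (i, L)) / B i * (betaWeight i (N - i) s *
              (f s * expect F L (Fin.snoc (α := fun _ => I) r s))) := fun i L =>
          integrable_of_continuous (continuous_const.mul ((continuous_betaWeight _ _).mul
            (hf.mul (continuous_expect_snoc hF L r))))
        simp only [h3]
        rw [integral_finsetSum _ fun i _ => integrable_finsetSum _ fun L _ => hint i L]
        refine Finset.sum_congr rfl fun i _ => ?_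
        rw [integral_finsetSum _ fun L _ => hint i L]
        refine Finset.sum_congr rfl fun L _ => ?_
        rw [integral_const_mul, integral_betaI]
        simp only [B]
        ring
    have hinr : ∀ i L, c (.inr (i, L)) = 0 := by
      intro i L
      -- Off the range of `r` the extended tuple is again injective, so induction applies for each
      -- such `s`.
      have h1 : ∀ s ∉ Set.range r, ∑ i : Fin (N + 1),
          c (.inr (i, L)) / B i * betaWeight i (N - i) s = 0 := fun s hs =>
        ih (injective_snoc hr hs) _ (fun F hF =>
          (eq_zero_of_dirac_add_density hr (hφ F hF) (key F hF)).2 s hs) L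
      have h2 := congrFun (eq_zero_of_sum_betaWeight_eq_zero _ (Set.finite_range r) h1) i
      exact (div_eq_zero_iff.1 h2).resolve_right (hB i)
    rintro (⟨q, L⟩ | ⟨i, L⟩)
    · exact ih hr (fun L => c (.inl (q, L))) (fun F hF =>
        (eq_zero_of_dirac_add_density hr (hφ F hF) (key F hF)).1 q) L
    · exact hinr i L

variable {k : ℕ} {Δ : Fin k → ℕ}

/-- Products of functions of the arguments of the variable `x₀`. -/
noncomputable def productTest (x₀ : Fin k) (F : ℕ → I → ℝ) (y : Space Δ) : ℝ :=
  (if y.1 = x₀ then 1 else 0) * ∏ c : Fin (Δ y.1), F c (y.2 c)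

theorem continuous_productTest (x₀ : Fin k) {F : ℕ → I → ℝ} (hF : ∀ n, Continuous (F n))
    (x : Fin k) : Continuous fun v : Fin (Δ x) → I => productTest x₀ F ⟨x, v⟩ := by
  have h : Continuous fun v : Fin (Δ x) → I => ∏ c : Fin (Δ x), F c (v c) :=
    continuous_finsetProd _ fun c _ => (hF c).comp (continuous_apply c)
  exact h.const_mul (if x = x₀ then 1 else 0)

theorem sem_toTerm (x₀ x : Fin k) {ℓ a m : ℕ} (F : ℕ → I → ℝ) (h : a + m = Δ x)
    (f : Fin a → Fin ℓ) (L : Chain N ℓ m) (r : Fin ℓ → I) :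
    sem (productTest x₀ F) (toTerm x h f L) r = (if x = x₀ then 1 else 0) *
      ((∏ c : Fin a, F c (r (f c))) * expect (fun c => F (a + c)) L r) := by
  induction m generalizing ℓ a with
  | zero =>
    simp only [toTerm, sem, productTest, expect, mul_one]
    congr 1
    exact Fintype.prod_equiv (finCongr h.symm) _ _ fun c => rfl
  | succ m ih =>
    have e : (fun c => F (a + 1 + c)) = fun c => F (a + (c + 1)) := by
      funext c
      congr 1
      omega
    rcases L with ⟨q, L⟩ | ⟨i, L⟩
    · rw [toTerm, ih, Fin.prod_univ_castSucc, e]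
      simp [expect, mul_assoc]
    · simp only [toTerm, sem, ih, Fin.prod_univ_castSucc, e, expect]
      rw [← integral_const_mul, ← integral_const_mul]
      simp [mul_assoc]

end Chain

/-! ### Trees of real numbers -/

section RealTree

variable {ℓ : ℕ}

/-- The full tree of choices with real leaves. -/
noncomputable def realTree (r : Fin ℓ → I) : List (Fin ℓ) → ((Fin ℓ →₀ ℕ) → ℝ) → ℝ
  | [], φ => φ 0
  | p :: w, φ => (r p : ℝ) * realTree r w (fun e => φ (e + Finsupp.single p 1)) +
      (1 - (r p : ℝ)) * realTree r w φ

theorem realTree_sum {ι : Type*} (s : Finset ι) (r : Fin ℓ → I) (w : List (Fin ℓ))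
    (φ : ι → (Fin ℓ →₀ ℕ) → ℝ) (a : ι → ℝ) :
    realTree r w (fun e => ∑ i ∈ s, φ i e * a i) = ∑ i ∈ s, realTree r w (φ i) * a i := by
  induction w generalizing φ with
  | nil => rfl
  | cons p w ih =>
    simp only [realTree]
    rw [ih, ih, Finset.mul_sum, Finset.mul_sum, ← Finset.sum_add_distrib]
    exact Finset.sum_congr rfl fun i _ => by ring

theorem realTree_sub (r : Fin ℓ → I) (w : List (Fin ℓ)) (φ ψ : (Fin ℓ →₀ ℕ) → ℝ) :
    realTree r w (fun e => φ e - ψ e) = realTree r w φ - realTree r w ψ := by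
  induction w generalizing φ ψ with
  | nil => rfl
  | cons p w ih =>
    simp only [realTree]
    rw [ih, ih]
    ring

/-- The polynomial in the odds of the parameters that a tree of real numbers defines. -/
noncomputable def polyTree : List (Fin ℓ) → ((Fin ℓ →₀ ℕ) → ℝ) → MvPolynomial (Fin ℓ) ℝ
  | [], φ => MvPolynomial.C (φ 0)
  | p :: w, φ => MvPolynomial.X p * polyTree w (fun e => φ (e + Finsupp.single p 1)) +
      polyTree w φ

/-- Multiplying a choice on `p` by `1 + u p` turns its probabilities into `u p` and `1`. -/
theorem eval_polyTree (u : Fin ℓ → ℝ) (hu : ∀ p, 0 < u p) (w : List (Fin ℓ))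
    (φ : (Fin ℓ →₀ ℕ) → ℝ) : MvPolynomial.eval u (polyTree w φ) =
      (w.map fun p => 1 + u p).prod * realTree (fun p => ofOdds (u p) (hu p)) w φ := by
  induction w generalizing φ with
  | nil => simp [polyTree, realTree]
  | cons p w ih =>
    have := hu p
    simp only [polyTree, realTree, map_add, map_mul, MvPolynomial.eval_X, ih, List.map_cons,
      List.prod_cons, coe_ofOdds]
    field_simp
    ring

/-- The number `a e` counts the paths to the leaf `e`, a product of binomial coefficients by
Pascal's rule; only its positivity at reachable leaves and its independence of `φ` matter. -/
theorem exists_coeff_polyTree (w : List (Fin ℓ)) : ∃ a : (Fin ℓ →₀ ℕ) → ℝ,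
    (∀ φ e, (polyTree w φ).coeff e = a e * φ e) ∧ (∀ e, 0 ≤ a e) ∧
      ∀ e, (∀ q, e q ≤ w.count q) → 0 < a e := by
  induction w with
  | nil =>
    refine ⟨fun e => if e = 0 then 1 else 0, fun φ e => ?_, fun e => ?_, fun e he => ?_⟩
    · by_cases h : e = 0
      · simp [polyTree, h]
      · simp [polyTree, MvPolynomial.coeff_C, h, Ne.symm h]
    · positivity
    · have : e = 0 := by
        ext q
        simpa using he q
      simp [this]
  | cons p w ih =>
    obtain ⟨a, ha, h0, hpos⟩ := ih
    refine ⟨fun e => (if p ∈ e.support then a (e - Finsupp.single p 1) else 0) + a e,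
      fun φ e => ?_, fun e => ?_, fun e he => ?_⟩
    · rw [polyTree, MvPolynomial.coeff_add, MvPolynomial.coeff_X_mul', ha, ha]
      by_cases h : p ∈ e.support
      · simp only [if_pos h]
        rw [tsub_add_cancel_of_le]
        · ring
        · rw [Finsupp.single_le_iff]
          exact Nat.one_le_iff_ne_zero.2 (Finsupp.mem_support_iff.1 h)
      · simp only [if_neg h]
        ring
    · have := h0 e
      have := h0 (e - Finsupp.single p 1)
      positivity
    · by_cases h : p ∈ e.support
      · simp only [if_pos h]
        refine add_pos_of_pos_of_nonneg (hpos _ fun q => ?_) (h0 e)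
        have := he q
        rw [List.count_cons] at this
        rw [Finsupp.tsub_apply, Finsupp.single_apply]
        by_cases hq : p = q
        · simp only [hq, beq_self_eq_true, if_true] at this ⊢
          omega
        · simpa [hq] using this
      · simp only [if_neg h, zero_add]
        refine hpos e fun q => ?_
        by_cases hq : p = q
        · rw [← hq, Finsupp.notMem_support_iff.1 h]
          exact Nat.zero_le _
        · have := he q
          rwa [List.count_cons_of_ne hq] at this

theorem eq_zero_of_realTree_eq_zero (w : List (Fin ℓ)) (φ : (Fin ℓ →₀ ℕ) → ℝ)
    (h : ∀ r : Fin ℓ → I, Function.Injective r → realTree r w φ = 0) (e : Fin ℓ →₀ ℕ)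
    (he : ∀ q, e q ≤ w.count q) : φ e = 0 := by
  have hP : polyTree w φ = 0 := by
    -- Disjoint intervals for the odds make the parameters pairwise distinct, and products of
    -- infinite sets still determine a polynomial.
    refine MvPolynomial.funext_set (fun p : Fin ℓ => Set.Ioo ((p : ℕ) : ℝ) ((p : ℕ) + 1))
      (fun p => Set.Ioo_infinite (by linarith)) fun u hu => ?_
    have hu : ∀ p : Fin ℓ, u p ∈ Set.Ioo ((p : ℕ) : ℝ) ((p : ℕ) + 1) := fun p => hu p trivial
    have hpos : ∀ p, 0 < u p := fun p => lt_of_le_of_lt (Nat.cast_nonneg _) (hu p).1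
    rw [eval_polyTree u hpos, h, mul_zero, map_zero]
    intro p q hpq
    have h1 : u p = u q := by
      rw [← odds_ofOdds (u p) (hpos p), ← odds_ofOdds (u q) (hpos q)]
      exact congrArg (fun s : I => (s : ℝ) / (1 - (s : ℝ))) hpq
    have h2 : (p : ℕ) < (q : ℕ) + 1 := by
      have := (hu p).1.trans (h1 ▸ (hu q).2)
      exact_mod_cast this
    have h3 : (q : ℕ) < (p : ℕ) + 1 := by
      have := (hu q).1.trans (h1 ▸ (hu p).2)
      exact_mod_cast this
    exact Fin.ext (by omega)
  obtain ⟨a, ha, -, hpos⟩ := exists_coeff_polyTree w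
  have := ha φ e
  rw [hP, MvPolynomial.coeff_zero] at this
  exact (mul_eq_zero.1 this.symm).resolve_left (hpos e he).ne'

end RealTree

/-! ### Completeness -/

section Completeness

variable {k : ℕ} {Δ : Fin k → ℕ} {ℓ N : ℕ}

open TermClass

variable {G : Space Δ → ℝ} (hG : ∀ x, Continuous fun v : Fin (Δ x) → I => G ⟨x, v⟩)

theorem expect_tree (w : List (Fin ℓ)) (g : (Fin ℓ →₀ ℕ) → TermClass Δ ℓ) (r : Fin ℓ → I) :
    expect G hG (tree w g) r = realTree r w fun e => expect G hG (g e) r := by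
  have hp : ∀ (p : Fin ℓ) (x y : TermClass Δ ℓ), expect G hG (pch p x y) r =
      (r p : ℝ) * expect G hG x r + (1 - (r p : ℝ)) * expect G hG y r := fun p x y => by
    induction x using ind with | _ x
    induction y using ind with | _ y
    rfl
  induction w generalizing g with
  | nil => rfl
  | cons p w ih => rw [tree, hp, ih, ih, realTree]

theorem expect_mix {i j : ℕ} (h : 0 < i + j) (x y : TermClass Δ ℓ) (r : Fin ℓ → I) :
    ((i + j : ℕ) : ℝ) * expect G hG (RationalConvex.mix i j x y) r =
      i * expect G hG x r + j * expect G hG y r := by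
  rw [mix_def h]
  induction x using ind with | _ x
  induction y using ind with | _ y
  rw [Nat.cast_add]
  exact mul_div_cancel₀ _ (cast_add_ne_zero h)

theorem expect_isAverage {S : Multiset (TermClass Δ ℓ)} {y : TermClass Δ ℓ} (hy : IsAverage S y)
    (r : Fin ℓ → I) :
    (S.card : ℝ) * expect G hG y r = (S.map fun x => expect G hG x r).sum := by
  -- By uniqueness it suffices to treat an average built along the induction on `S`.
  suffices h : ∃ y, IsAverage S y ∧
      (S.card : ℝ) * expect G hG y r = (S.map fun x => expect G hG x r).sum by
    obtain ⟨y', hy', e⟩ := h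
    rwa [hy.unique hy']
  have hS := hy.1
  clear hy
  induction S using Multiset.induction_on with
  | empty => exact absurd rfl hS
  | cons x S ih =>
    by_cases h0 : S = 0
    · subst h0
      exact ⟨x, IsAverage.singleton x, by simp⟩
    · obtain ⟨y, hy, e⟩ := ih h0
      have hc : 0 < 1 + S.card := by omega
      refine ⟨RationalConvex.mix 1 S.card x y, ⟨Multiset.cons_ne_zero, ?_⟩, ?_⟩
      · rw [Multiset.card_cons, add_comm, toCone_mix hc, hy.2]
        simp
      · rw [Multiset.card_cons, add_comm, expect_mix hG hc, e]
        simp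

/-- The relative frequency of an element of a multiset. -/
noncomputable def frequency {X : Type*} [DecidableEq X] (S : Multiset X) (x : X) : ℝ :=
  (S.count x : ℝ) / S.card

theorem expect_isChainAverage {S : Multiset (Σ x : Fin k, Chain N ℓ (Δ x))} {y : TermClass Δ ℓ}
    (hy : IsAverage (S.map chainClass) y) (r : Fin ℓ → I) :
    expect G hG y r = ∑ L, frequency S L * expect G hG (chainClass L) r := by
  have hc : (S.card : ℝ) ≠ 0 := by
    have := hy.card_pos
    rw [Multiset.card_map] at this
    exact_mod_cast this.ne'
  have h := expect_isAverage hG hy r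
  rw [Multiset.card_map, Multiset.map_map, Finset.sum_multiset_map_count] at h
  rw [← mul_right_inj' hc, h, Finset.mul_sum]
  refine (Finset.sum_subset (Finset.subset_univ _) fun L _ hL => ?_).trans
    (Finset.sum_congr rfl fun L _ => ?_)
  · rw [Multiset.count_eq_zero_of_notMem (by simpa using hL), zero_nsmul]
  · rw [nsmul_eq_mul, frequency, ← mul_assoc, mul_div_cancel₀ _ hc]
    simp only [Function.comp_apply]

/-- The sum over chains is pulled out of the tree. At each injective `r`, independence of chains
makes the tree of frequency differences vanish for each chain; as `r` varies, every reachable leaf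
difference vanishes. -/
theorem frequency_eq_of_expect_eq (w : List (Fin ℓ)) {g g' : (Fin ℓ →₀ ℕ) → TermClass Δ ℓ}
    {S S' : (Fin ℓ →₀ ℕ) → Multiset (Σ x : Fin k, Chain N ℓ (Δ x))}
    (hS : ∀ e, IsAverage ((S e).map chainClass) (g e))
    (hS' : ∀ e, IsAverage ((S' e).map chainClass) (g' e))
    (h : ∀ (G : Space Δ → ℝ) (hG : ∀ x, Continuous fun v : Fin (Δ x) → I => G ⟨x, v⟩)
      (r : Fin ℓ → I), expect G hG (tree w g) r = expect G hG (tree w g') r)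
    (e : Fin ℓ →₀ ℕ) (he : ∀ q, e q ≤ w.count q) (L : Σ x : Fin k, Chain N ℓ (Δ x)) :
    frequency (S e) L = frequency (S' e) L := by
  rw [← sub_eq_zero]
  refine eq_zero_of_realTree_eq_zero w (fun e => frequency (S e) L - frequency (S' e) L)
    (fun r hr => ?_) e he
  obtain ⟨x₀, L⟩ := L
  refine Chain.eq_zero_of_sum_expect_eq_zero hr (fun L => realTree r w fun e =>
    frequency (S e) ⟨x₀, L⟩ - frequency (S' e) ⟨x₀, L⟩) (fun F hF => ?_) L
  have hG := Chain.continuous_productTest (Δ := Δ) x₀ hF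
  have h1 := h _ hG r
  rw [expect_tree, expect_tree] at h1
  simp only [expect_isChainAverage hG (hS _), expect_isChainAverage hG (hS' _),
    realTree_sum] at h1
  rw [← sub_eq_zero, ← Finset.sum_sub_distrib, Fintype.sum_sigma, Finset.sum_eq_single x₀] at h1
  · rw [← h1]
    refine Finset.sum_congr rfl fun L _ => ?_
    have e1 : TermClass.expect (Chain.productTest x₀ F) hG (chainClass ⟨x₀, L⟩) r =
        Chain.expect F L r := by
      refine (Chain.sem_toTerm x₀ x₀ F (Nat.zero_add _) Fin.elim0 L r).trans ?_
      simp
    rw [realTree_sub, e1]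
    ring
  · intro x _ hx
    refine Finset.sum_eq_zero fun L _ => ?_
    have e1 : TermClass.expect (Chain.productTest x₀ F) hG (chainClass ⟨x, L⟩) r = 0 := by
      refine (Chain.sem_toTerm x₀ x F (Nat.zero_add _) Fin.elim0 L r).trans ?_
      simp [hx]
    rw [e1]
    ring
  · simp

theorem isAverage_eq_of_frequency_eq {S S' : Multiset (Σ x : Fin k, Chain N ℓ (Δ x))}
    {y y' : TermClass Δ ℓ} (hS : IsAverage (S.map chainClass) y)
    (hS' : IsAverage (S'.map chainClass) y') (h : ∀ L, frequency S L = frequency S' L) :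
    y = y' := by
  refine hS.eq_of_proportional hS' ?_
  have hc := hS.card_pos
  have hc' := hS'.card_pos
  rw [Multiset.card_map] at hc hc'
  rw [Multiset.card_map, Multiset.card_map, ← Multiset.map_nsmul, ← Multiset.map_nsmul]
  congr 1
  ext L
  rw [Multiset.count_nsmul, Multiset.count_nsmul]
  have h1 := h L
  rw [frequency, frequency, div_eq_div_iff (by exact_mod_cast hc.ne')
    (by exact_mod_cast hc'.ne')] at h1
  have h2 : S.count L * S'.card = S'.count L * S.card := by exact_mod_cast h1
  linarith

theorem deriv_of_interp_eq (t t' : Term Δ ℓ) (h : t.interp = t'.interp) : Deriv t t' := by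
  obtain ⟨N₁, w₁, h₁⟩ := exists_isNormal t
  obtain ⟨N₂, w₂, h₂⟩ := exists_isNormal t'
  -- Both terms are put over the common list `w₁ ++ w₂` and the common `N = max N₁ N₂`.
  obtain ⟨g, hg, e⟩ := (h₁ _ (le_max_left N₁ N₂)).append_right w₂
  obtain ⟨g', hg', e'⟩ := (h₂ _ (le_max_right N₁ N₂)).append_left w₁
  choose S hS using hg
  choose S' hS' using hg'
  refine (mk_eq_mk.1 ?_).1
  rw [e, e']
  refine tree_congr _ fun d hd => isAverage_eq_of_frequency_eq (hS d) (hS' d) fun L =>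
    frequency_eq_of_expect_eq _ hS hS' (fun G hG r => ?_) d hd L
  rw [← e, ← e']
  exact (integral_interp hG t r).symm.trans ((congrArg (fun κ => ∫ y, G y ∂κ r) h).trans (integral_interp hG t' r))

end Completeness

end BetaBernoulli

theorem mainTheorem1 {k ℓ : ℕ} {Δ : Fin k → ℕ} (t t' : BetaBernoulli.Term Δ ℓ)
    (h : t.interp = t'.interp) : BetaBernoulli.Deriv t t' :=
  BetaBernoulli.deriv_of_interp_eq t t' h
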